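/- **Setting.** Types, up to renaming of bound variables, are given by $T ::= \top \mid X \mid T\to T \mid \forall^{K}(X<:T).T \mid \forall^{\top}(X<:T).T$, and terms by $t ::= \mathsf{top} \mid x \mid \lambda(x:T).t \mid \Lambda(X<:T).t \mid t\,t \mid t\{T\}$. A context $\Theta$ is a sequence of assumptions $X<:T$ and $x:T$ on distinct variables; $\Theta\vdash T$ means that $\Theta$ is well-formed (each type in it is well-formed over the preceding part) and that all free type variables of $T$ are declared in $\Theta$. System $F_{\le}^{K\top}$ has the *subtyping* judgments $\Theta\vdash S<:T$ generated by: $X<:T$ if $X<:T$ occurs in the well-formed context $\Theta$; $T<:\top$ and $T<:T$ for $\Theta\vdash T$; transitivity; and * $S\to T<:S'\to T'$ if $\Theta\vdash S'<:S$ and $\Theta\vdash T<:T'$; * $\forall^{K}(X<:S).T<:\forall^{K}(X<:S).T'$ if $\Theta,X<:S\vdash T<:T'$; * $\forall^{K}(X<:S_0).S_1<:\forall^{\top}(X<:T_0).T_1$ if $\Theta\vdash T_0<:S_0$ and $\Theta,X<:S_0\vdash S_1<:T_1$; * $\forall^{\top}(X<:S_0).S_1<:\forall^{\top}(X<:T_0).T_1$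 if $\Theta\vdash T_0<:S_0$ and $\Theta,X<:\top\vdash S_1<:T_1$. Its *typing* judgments $\Theta\vdash t:T$ are generated by the usual rules for $\mathsf{top}:\top$, variables, $\lambda$-abstraction and application, subsumption (from $t:T$ and $T<:T'$ infer $t:T'$), and by: $\Theta\vdash\Lambda(X<:S).t:\forall^{K}(X<:S).T$ if $\Theta,X<:S\vdash t:T$; and $\Theta\vdash t\{S'\}:T[S'/X]$ if $\Theta\vdash t:\forall^{\top}(X<:S).T$ and $\Theta\vdash S'<:S$. *Subtyping algorithm*: deterministic backward search for a derivation of $\Theta\vdash_A S<:T$ with the rules above for $\to$ and for the quantifiers (read with $\vdash_A$), together with: $T<:\top$ if $\Theta\vdash T$; $X<:X$ if $\Theta\vdash X$; and, if $T\not\equiv\top,X$ and $X$ has bound $S$ in $\Theta$, $X<:T$ if $\Theta\vdash_A S<:T$. A judgment matching no rule is rejected. *Minimal typing algorithm*: deterministic backward search for $T$ with $\Theta\vdash_M t:T$. Let $\Theta^*(T)$ be obtained from $T$ by replacing a type variable by its bound in $\Theta$ until the result is not a variable. The rules are: $\mathsf{top}:\top$; $x:T$ if $x:T$ occurs in $\Theta$;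 $\lambda(x:S).t:S\to T$ if $\Theta\vdash S$ and $\Theta,x:S\vdash_M t:T$; $\Lambda(X<:S).t:\forall^{K}(X<:S).T$ if $\Theta\vdash S$ and $\Theta,X<:S\vdash_M t:T$; $r\,s:T$ if $\Theta\vdash_M r:R$, $\Theta\vdash_M s:S$, $\Theta^*(R)=S'\to T$ and the subtyping algorithm accepts $S<:S'$; $r\{S\}:T[S/X]$ if $\Theta\vdash_M r:R$, $\Theta^*(R)$ is $\forall^{K}(X<:S').T$ or $\forall^{\top}(X<:S').T$, and the subtyping algorithm accepts $S<:S'$. If no rule applies, $t$ is rejected. *Typechecking procedure* on $(\Theta,t,T)$: run the minimal typing algorithm on $\Theta\vdash t$; if it rejects, reject; if it produces $S$, answer as the subtyping algorithm does on $\Theta\vdash_A S<:T$. An $F_{\le}^{\top}$-type $\Theta\vdash^{\top}T$ is a type $\Theta\vdash T$, and an $F_{\le}^{\top}$-term $\Theta\vdash^{\top}t$ a well-formed context $\Theta$ with a raw term $t$, such that all quantifiers in $\Theta$ and $T$ (respectively $\Theta$ and $t$) are $\forall^{\top}$. The *minimal types for $F_{\le}^{\top}$* are given by the grammar $T::=S\mid\forall^{K}(X<:S).T\mid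 S\to T$, where $S$ ranges over the types all of whose quantifiers are $\forall^{\top}$. **Proposition** (typechecking of $F_{\le}^{\top}$-terms in System $F_{\le}^{K\top}$ is decidable). 1. On every $F_{\le}^{\top}$-term $\Theta\vdash^{\top}t$ the minimal typing algorithm terminates; it either rejects or produces a type $\Theta\vdash S$ that is a minimal type for $F_{\le}^{\top}$. 2. If $\Theta\vdash S$ is a minimal type for $F_{\le}^{\top}$ and $\Theta\vdash^{\top}T$ is an $F_{\le}^{\top}$-type, then the subtyping algorithm terminates on $\Theta\vdash_A S<:T$. 3. For every $F_{\le}^{\top}$-term $\Theta\vdash^{\top}t$ and $F_{\le}^{\top}$-type $\Theta\vdash^{\top}T$, the typechecking procedure terminates on $(\Theta,t,T)$, and it accepts if and only if $\Theta\vdash t:T$ is derivable in System $F_{\le}^{K\top}$. 4. Consequently the set of (Gödel numbers of) triples $(\Theta,t,T)$ such that $\Theta\vdash^{\top}t$, $\Theta\vdash^{\top}T$ and $\Theta\vdash t:T$ is derivable in System $F_{\le}^{K\top}$ is decidable (recursive). -/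

import Mathlib

namespace FSub

/-! ### Raw syntax

Types, terms and contexts up to renaming of bound variables, with de Bruijn indices. Type variables
and term variables have separate index spaces: a type variable index counts only type-variable
entries of the context, a term variable index counts only term-variable entries. -/

/-- The two forms of bounded quantifier: `K` (kernel) and `top`. -/
inductive Quant where
  | K
  | top
  deriving DecidableEq

/-- Raw types: `⊤`, type variables, `S → T`, `∀^q (X <: S). T`. -/
inductive Ty where
  | top
  | var (i : ℕ)
  | arrow (S T : Ty)
  | all (q : Quant) (bound body : Ty)
  deriving DecidableEq

/-- Raw terms: `top`, term variables, `λ (x : S). t`, `Λ (X <: S). t`, `t s`, `t {S}`. -/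
inductive Tm where
  | top
  | var (i : ℕ)
  | lam (S : Ty) (t : Tm)
  | tlam (S : Ty) (t : Tm)
  | app (t s : Tm)
  | tapp (t : Tm) (S : Ty)

/-- A context entry: `X <: S` or `x : S`. -/
inductive Entry where
  | ty (bound : Ty)
  | tm (type : Ty)

/-- Contexts, most recent entry first. The type in an entry lives over the entries after it in the
list, that is, over the older part of the context. -/
abbrev Ctx := List Entry

/-- Weakening of a type by one new type variable, inserted at index `c`. -/
def Ty.shift (c : ℕ) : Ty → Ty
  | .top => .top
  | .var i => .var (if i < c then i else i + 1)
  | .arrow S T => .arrow (S.shift c) (T.shift c)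
  | .all q S T => .all q (S.shift c) (T.shift (c + 1))

/-- Substitution of `U` for the type variable with index `c`, which is removed from the scope. -/
def Ty.subst (c : ℕ) (U : Ty) : Ty → Ty
  | .top => .top
  | .var i => if i < c then .var i else if i = c then U else .var (i - 1)
  | .arrow S T => .arrow (Ty.subst c U S) (Ty.subst c U T)
  | .all q S T => .all q (Ty.subst c U S) (Ty.subst (c + 1) (U.shift 0) T)

/-- The bound, as a type over `Θ`, of the type variable with index `i` in `Θ`. -/
def Ctx.bound : Ctx → ℕ → Option Ty
  | [], _ => none
  | .tm _ :: Θ, i => Ctx.bound Θ i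
  | .ty S :: _, 0 => some (S.shift 0)
  | .ty _ :: Θ, i + 1 => (Ctx.bound Θ i).map (Ty.shift 0)

/-- The type, as a type over `Θ`, of the term variable with index `i` in `Θ`. -/
def Ctx.type : Ctx → ℕ → Option Ty
  | [], _ => none
  | .ty _ :: Θ, i => (Ctx.type Θ i).map (Ty.shift 0)
  | .tm S :: _, 0 => some S
  | .tm _ :: Θ, i + 1 => Ctx.type Θ i

/-! ### The type system -/

/-- `Wf Θ T` is `Θ ⊢ T`: `T` is a well-defined type in the well-defined context `Θ`.
In particular `Wf Θ .top` says that `Θ` is a well-defined context. -/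
inductive Wf : Ctx → Ty → Prop
  | nil : Wf [] .top
  | weakTy {Θ S T} : Wf Θ S → Wf Θ T → Wf (.ty S :: Θ) (T.shift 0)
  | weakTm {Θ S T} : Wf Θ S → Wf Θ T → Wf (.tm S :: Θ) T
  | var {Θ S} : Wf (.ty S :: Θ) .top → Wf (.ty S :: Θ) (.var 0)
  | arrow {Θ S T} : Wf Θ S → Wf Θ T → Wf Θ (.arrow S T)
  | all {Θ q S T} : Wf (.ty S :: Θ) T → Wf Θ (.all q S T)

/-- `Sub Θ S T` is the declarative subtyping judgment `Θ ⊢ S <: T`. -/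
inductive Sub : Ctx → Ty → Ty → Prop
  | var {Θ i T} : Wf Θ .top → Ctx.bound Θ i = some T → Sub Θ (.var i) T
  | top {Θ T} : Wf Θ T → Sub Θ T .top
  | refl {Θ T} : Wf Θ T → Sub Θ T T
  | trans {Θ T T' T''} : Sub Θ T T' → Sub Θ T' T'' → Sub Θ T T''
  | arrow {Θ S S' T T'} : Sub Θ S' S → Sub Θ T T' → Sub Θ (.arrow S T) (.arrow S' T')
  | allFun {Θ S T T'} : Sub (.ty S :: Θ) T T' → Sub Θ (.all .K S T) (.all .K S T')
  | allLoc {Θ S₀ S₁ T₀ T₁} : Sub Θ T₀ S₀ → Sub (.ty S₀ :: Θ) S₁ T₁ →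
      Sub Θ (.all .K S₀ S₁) (.all .top T₀ T₁)
  | allTop {Θ S₀ S₁ T₀ T₁} : Sub Θ T₀ S₀ → Sub (.ty .top :: Θ) S₁ T₁ →
      Sub Θ (.all .top S₀ S₁) (.all .top T₀ T₁)

/-- `Typing Θ t T` is the declarative typing judgment `Θ ⊢ t : T`. -/
inductive Typing : Ctx → Tm → Ty → Prop
  | top {Θ} : Wf Θ .top → Typing Θ .top .top
  | var {Θ i T} : Wf Θ .top → Ctx.type Θ i = some T → Typing Θ (.var i) T
  | sub {Θ t T T'} : Typing Θ t T → Sub Θ T T' → Typing Θ t T'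
  | arrowI {Θ S t T} : Typing (.tm S :: Θ) t T → Typing Θ (.lam S t) (.arrow S T)
  | arrowE {Θ t s S T} : Typing Θ t (.arrow S T) → Typing Θ s S → Typing Θ (.app t s) T
  | allI {Θ S t T} : Typing (.ty S :: Θ) t T → Typing Θ (.tlam S t) (.all .K S T)
  | allE {Θ t S S' T} : Typing Θ t (.all .top S T) → Sub Θ S' S →
      Typing Θ (.tapp t S') (Ty.subst 0 S' T)

/-! ### The fragment in which all quantifiers are `∀^⊤` -/

/-- All quantifiers in the type are `∀^⊤`. -/
def Ty.IsFTop : Ty → Prop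
  | .top => True
  | .var _ => True
  | .arrow S T => S.IsFTop ∧ T.IsFTop
  | .all q S T => q = .top ∧ S.IsFTop ∧ T.IsFTop

/-- All quantifiers in the type annotations and type arguments of the term are `∀^⊤`. -/
def Tm.IsFTop : Tm → Prop
  | .top => True
  | .var _ => True
  | .lam S t => S.IsFTop ∧ t.IsFTop
  | .tlam S t => S.IsFTop ∧ t.IsFTop
  | .app t s => t.IsFTop ∧ s.IsFTop
  | .tapp t S => t.IsFTop ∧ S.IsFTop

/-- All quantifiers in the context are `∀^⊤`. -/
def Ctx.IsFTop : Ctx → Prop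
  | [] => True
  | .ty S :: Θ => S.IsFTop ∧ Ctx.IsFTop Θ
  | .tm S :: Θ => S.IsFTop ∧ Ctx.IsFTop Θ

/-- `Θ ⊢^⊤ T`: a well-formed type-in-context, all of whose quantifiers are `∀^⊤`. -/
def FTopType (Θ : Ctx) (T : Ty) : Prop := Wf Θ T ∧ Ctx.IsFTop Θ ∧ T.IsFTop

/-- `Θ ⊢^⊤ t`: a well-formed context together with a raw term, all of whose quantifiers
are `∀^⊤`. -/
def FTopTerm (Θ : Ctx) (t : Tm) : Prop := Wf Θ .top ∧ Ctx.IsFTop Θ ∧ t.IsFTop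

/-- The grammar `T ::= S | ∀^K (X <: S). T | S → T`, where `S` ranges over the types all of whose
quantifiers are `∀^⊤`. -/
inductive Ty.IsMinimal : Ty → Prop
  | ftop {S : Ty} : S.IsFTop → IsMinimal S
  | all {S T : Ty} : S.IsFTop → IsMinimal T → IsMinimal (.all .K S T)
  | arrow {S T : Ty} : S.IsFTop → IsMinimal T → IsMinimal (.arrow S T)

/-! ### The algorithms -/

/-- The number of type variables declared in a context. -/
def Ctx.numTy : Ctx → ℕ
  | [] => 0
  | .ty _ :: Θ => Ctx.numTy Θ + 1
  | .tm _ :: Θ => Ctx.numTy Θ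

/-- Test that all free type variables have an index below `n`. -/
def Ty.scoped : ℕ → Ty → Bool
  | _, .top => true
  | n, .var i => decide (i < n)
  | n, .arrow S T => S.scoped n && T.scoped n
  | n, .all _ S T => S.scoped n && T.scoped (n + 1)

/-- Test that a context is well-formed. -/
def Ctx.check : Ctx → Bool
  | [] => true
  | .ty S :: Θ => Ctx.check Θ && S.scoped (Ctx.numTy Θ)
  | .tm S :: Θ => Ctx.check Θ && S.scoped (Ctx.numTy Θ)

/-- Test for `Θ ⊢ T`. -/
def wfCheck (Θ : Ctx) (T : Ty) : Bool := Ctx.check Θ && T.scoped (Ctx.numTy Θ)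

/-- Combine the answers to two subgoals, both of which are searched. -/
def both (x y : Option Bool) : Option Bool :=
  x.bind fun a => y.map fun b => a && b

/-- The subtyping algorithm: the deterministic search for a derivation of `Θ ⊢_A S <: T` by the
algorithmic subtyping rules, run with recursion depth at most `n`. The value `some true` means
acceptance, `some false` rejection, and `none` that the search is not complete at this depth. -/
def subtype : ℕ → Ctx → Ty → Ty → Option Bool
  | 0, _, _, _ => none
  | _ + 1, Θ, S, .top => some (wfCheck Θ S)
  | n + 1, Θ, .var i, T =>
      if T = .var i then some (wfCheck Θ (.var i))
      else match Ctx.bound Θ i with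
        | some S => subtype n Θ S T
        | none => some false
  | n + 1, Θ, .arrow S T, .arrow S' T' => both (subtype n Θ S' S) (subtype n Θ T T')
  | n + 1, Θ, .all .K S T, .all .K S' T' =>
      if S = S' then subtype n (.ty S :: Θ) T T' else some false
  | n + 1, Θ, .all .K S₀ S₁, .all .top T₀ T₁ =>
      both (subtype n Θ T₀ S₀) (subtype n (.ty S₀ :: Θ) S₁ T₁)
  | n + 1, Θ, .all .top S₀ S₁, .all .top T₀ T₁ =>
      both (subtype n Θ T₀ S₀) (subtype n (.ty .top :: Θ) S₁ T₁)
  | _ + 1, _, _, _ => some false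

/-- The least non-atomic supertype `Θ^*(T)`: a type variable is replaced by its bound until the
type is not a variable. (An undeclared variable is left unchanged.) -/
def Ctx.expose : Ctx → Ty → Ty
  | [], T => T
  | .tm _ :: Θ, .var i => Ctx.expose Θ (.var i)
  | .ty S :: Θ, .var 0 => (Ctx.expose Θ S).shift 0
  | .ty _ :: Θ, .var (i + 1) => (Ctx.expose Θ (.var i)).shift 0
  | _ :: _, T => T

/-- The minimal typing algorithm: the deterministic search for a type `T` with `Θ ⊢_M t : T`, in
which each call of the subtyping algorithm is run with recursion depth at most `n`. The value
`some (some T)` means that the type `T` is produced, `some none` that the term is rejected, and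
`none` that some call of the subtyping algorithm is not complete at this depth. Before a context is
extended by a type annotation, this annotation is tested for well-formedness. -/
def synth (n : ℕ) : Ctx → Tm → Option (Option Ty)
  | _, .top => some (some .top)
  | Θ, .var i => some (Ctx.type Θ i)
  | Θ, .lam S t =>
      if wfCheck Θ S then (synth n (.tm S :: Θ) t).map fun r => r.map fun T => .arrow S T
      else some none
  | Θ, .tlam S t =>
      if wfCheck Θ S then (synth n (.ty S :: Θ) t).map fun r => r.map fun T => .all .K S T
      else some none
  | Θ, .app r s =>
      (synth n Θ r).bind fun oR =>
        match oR with
        | none => some none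
        | some R =>
          (synth n Θ s).bind fun oS =>
            match oS with
            | none => some none
            | some S =>
              match Ctx.expose Θ R with
              | .arrow S' T => (subtype n Θ S S').map fun b => if b then some T else none
              | _ => some none
  | Θ, .tapp r S =>
      (synth n Θ r).bind fun oR =>
        match oR with
        | none => some none
        | some R =>
          match Ctx.expose Θ R with
          | .all _ S' T =>
              (subtype n Θ S S').map fun b => if b then some (Ty.subst 0 S T) else none
          | _ => some none

/-- The typechecking procedure: synthesize a type `S` for `t`, then run the subtyping algorithm
on `Θ ⊢_A S <: T`. -/
def typecheck (n : ℕ) (Θ : Ctx) (t : Tm) (T : Ty) : Option Bool :=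
  (synth n Θ t).bind fun oS =>
    match oS with
    | none => some false
    | some S => subtype n Θ S T

/-- A procedure with a bound `n` on its recursion depth terminates with result `a`: every
sufficiently large bound is enough to complete the run, and the result is `a`. -/
def Returns {α : Type} (run : ℕ → Option α) (a : α) : Prop :=
  ∃ N, ∀ n, N ≤ n → run n = some a

/-- The procedure terminates. -/
def Terminates {α : Type} (run : ℕ → Option α) : Prop := ∃ a, Returns run a

/-! ### Gödel numbering of typing problems -/

/-- Gödel numbers of types. -/
def Ty.code : Ty → ℕ
  | .top => Nat.pair 0 0
  | .var i => Nat.pair 1 i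
  | .arrow S T => Nat.pair 2 (Nat.pair S.code T.code)
  | .all .K S T => Nat.pair 3 (Nat.pair S.code T.code)
  | .all .top S T => Nat.pair 4 (Nat.pair S.code T.code)

/-- Gödel numbers of terms. -/
def Tm.code : Tm → ℕ
  | .top => Nat.pair 0 0
  | .var i => Nat.pair 1 i
  | .lam S t => Nat.pair 2 (Nat.pair S.code t.code)
  | .tlam S t => Nat.pair 3 (Nat.pair S.code t.code)
  | .app t s => Nat.pair 4 (Nat.pair t.code s.code)
  | .tapp t S => Nat.pair 5 (Nat.pair t.code S.code)

/-- Gödel numbers of contexts. -/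
def Ctx.code : Ctx → ℕ
  | [] => Nat.pair 0 0
  | .ty S :: Θ => Nat.pair 1 (Nat.pair S.code (Ctx.code Θ))
  | .tm S :: Θ => Nat.pair 2 (Nat.pair S.code (Ctx.code Θ))

/-- The Gödel number of the typing problem `Θ ⊢ t : T`. -/
def problemCode (Θ : Ctx) (t : Tm) (T : Ty) : ℕ :=
  Nat.pair (Ctx.code Θ) (Nat.pair t.code T.code)

theorem Ty.code_injective : ∀ S T : Ty, S.code = T.code → S = T := by
  intro S
  induction S with
  | top => rintro (_ | _ | _ | ⟨_ | _, _, _⟩) h <;> simp_all [Ty.code]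
  | var i => rintro (_ | _ | _ | ⟨_ | _, _, _⟩) h <;> simp_all [Ty.code]
  | arrow A B ihA ihB =>
    rintro (_ | _ | ⟨_, _⟩ | ⟨_ | _, _, _⟩) h <;> simp [Ty.code] at h
    rw [ihA _ h.1, ihB _ h.2]
  | all q A B ihA ihB =>
    rcases q with _ | _ <;> rintro (_ | _ | ⟨_, _⟩ | ⟨_ | _, _, _⟩) h <;> simp [Ty.code] at h <;>
      rw [ihA _ h.1, ihB _ h.2]

theorem Tm.code_injective : ∀ s t : Tm, s.code = t.code → s = t := by
  intro s
  induction s with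
  | top => rintro (_ | _ | _ | _ | _ | _) h <;> simp_all [Tm.code]
  | var i => rintro (_ | _ | _ | _ | _ | _) h <;> simp_all [Tm.code]
  | lam S t ih =>
    rintro (_ | _ | _ | _ | _ | _) h <;> simp [Tm.code] at h
    rw [Ty.code_injective _ _ h.1, ih _ h.2]
  | tlam S t ih =>
    rintro (_ | _ | _ | _ | _ | _) h <;> simp [Tm.code] at h
    rw [Ty.code_injective _ _ h.1, ih _ h.2]
  | app t s iht ihs =>
    rintro (_ | _ | _ | _ | _ | _) h <;> simp [Tm.code] at h
    rw [iht _ h.1, ihs _ h.2]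
  | tapp t S ih =>
    rintro (_ | _ | _ | _ | _ | _) h <;> simp [Tm.code] at h
    rw [ih _ h.1, Ty.code_injective _ _ h.2]

theorem Ctx.code_injective : ∀ Θ Δ : Ctx, Ctx.code Θ = Ctx.code Δ → Θ = Δ := by
  intro Θ
  induction Θ with
  | nil => rintro (_ | ⟨_ | _, _⟩) h <;> simp_all [Ctx.code]
  | cons e Θ ih =>
    rcases e with _ | _ <;> rintro (_ | ⟨_ | _, _⟩) h <;> simp [Ctx.code] at h <;>
      rw [Ty.code_injective _ _ h.1, ih _ h.2]

/-- Distinct typing problems have distinct Gödel numbers. -/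
theorem problemCode_injective {Θ Θ' : Ctx} {t t' : Tm} {T T' : Ty}
    (h : problemCode Θ t T = problemCode Θ' t' T') : Θ = Θ' ∧ t = t' ∧ T = T' := by
  simp only [problemCode, Nat.pair_eq_pair] at h
  exact ⟨Ctx.code_injective _ _ h.1, Tm.code_injective _ _ h.2.1, Ty.code_injective _ _ h.2.2⟩

end FSub

namespace FSub

/-! ### Shifting, substitution and scoping -/

/-! The statement splits into correctness, which holds for the whole system, and termination, which
is special to the `∀^⊤` fragment.

Correctness rests on the elimination of transitivity: the declarative relation `Sub` and the
algorithmic relation `ASub` coincide (`ASub.sub`, `Sub.asub`). The usual obstacle is the narrowing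
of a bound in the body of a quantifier. Here two `∀^⊤` bodies are compared under the bound `⊤`, and
a `∀^K` type on the left keeps its own bound, so the only bounds ever narrowed are equal to `⊤`; an
algorithmic step through such a bound can only end at `⊤` (`ASub.narrow`). Given transitivity,
subsumption can be postponed to the end of a typing derivation: the synthesized type is derivable
(`typing_of_synth`) and lies below every other type of the term (`synth_of_typing`).

Termination of subtyping (`subtype_terminates_of_measure`) is a lexicographic induction on the
number of `∀^K` in the left type and then on the weight of both types. A variable declared in the
context weighs one more than its bound, and a variable bound inside a type weighs as if its bound
were `⊤`. Hence promotion of a variable, passage to the components of an arrow, and comparison of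
two `∀^⊤` types all lower the weight. Comparing `∀^K` with `∀^⊤` puts a real bound into the context
and may raise the weight of the bodies, but it uses up one `∀^K`. No `∀^K` ever comes back: the
right type, the bounds in the context, and the domains and quantifier bounds in a minimal type are
all free of `∀^K`, so a contravariant swap puts a `∀^K`-free type on the left. Minimal types are
preserved by all operations of synthesis, so every subtyping call made there is of this form.

For recursiveness, the run truncated at depth `n` is a computable function of `n` and the Gödel
number; each recursion involved is treated by the second recursion theorem
(`computable_of_binary_rec`). An answer found at one depth persists at all larger depths, so
unbounded search over `n` returns the right answer, and termination guarantees that it succeeds. -/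

theorem Ty.shift_shift (T : Ty) : ∀ c d, c ≤ d →
    (T.shift c).shift (d + 1) = (T.shift d).shift c := by
  induction T with
  | top => intros; rfl
  | var i => intro c d h; simp only [Ty.shift]; congr 1; split_ifs <;> omega
  | arrow S T ihS ihT => intro c d h; simp only [Ty.shift]; rw [ihS _ _ h, ihT _ _ h]
  | all q S T ihS ihT =>
    intro c d h; simp only [Ty.shift]; rw [ihS _ _ h, ihT _ _ (Nat.succ_le_succ h)]

theorem Ty.subst_shift (U T : Ty) : ∀ c, Ty.subst c U (T.shift c) = T := by
  induction T generalizing U with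
  | top => intros; rfl
  | var i =>
    intro c; simp only [Ty.shift]
    by_cases h : i < c
    · simp [h, Ty.subst]
    · have h1 : ¬ i + 1 < c := by omega
      have h2 : i + 1 ≠ c := by omega
      simp [h, h1, h2, Ty.subst]
  | arrow S T ihS ihT => intro c; simp only [Ty.shift, Ty.subst, ihS, ihT]
  | all q S T ihS ihT => intro c; simp only [Ty.shift, Ty.subst, ihS, ihT]

theorem Ty.shift_subst (T : Ty) : ∀ c d U, c ≤ d →
    (Ty.subst d U T).shift c = Ty.subst (d + 1) (U.shift c) (T.shift c) := by
  induction T with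
  | top => intros; rfl
  | var i =>
    intro c d U h
    rcases lt_trichotomy i d with h1 | h1 | h1
    · by_cases h2 : i < c
      · have : i < d + 1 := by omega
        simp [Ty.shift, Ty.subst, h1, h2, this]
      · simp [Ty.shift, Ty.subst, h1, h2]
    · subst h1
      have h2 : ¬ i < c := by omega
      simp [Ty.shift, Ty.subst, h2]
    · have e1 : ¬ i < d := by omega
      have e2 : i ≠ d := by omega
      have e3 : ¬ i < c := by omega
      have e4 : ¬ i - 1 < c := by omega
      have e5 : i - 1 + 1 = i := by omega
      simp [Ty.shift, Ty.subst, e1, e2, e3, e4, e5]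
  | arrow S T ihS ihT =>
    intro c d U h; simp only [Ty.shift, Ty.subst]; rw [ihS _ _ _ h, ihT _ _ _ h]
  | all q S T ihS ihT =>
    intro c d U h; simp only [Ty.shift, Ty.subst]
    rw [ihS _ _ _ h, ihT _ _ _ (Nat.succ_le_succ h), Ty.shift_shift U 0 c (Nat.zero_le _)]

theorem Ty.scoped_shift (T : Ty) : ∀ n c, T.scoped n = true → (T.shift c).scoped (n + 1) = true := by
  induction T with
  | top => intros; rfl
  | var i => intro n c h; simp only [Ty.shift, Ty.scoped, decide_eq_true_eq] at *; split_ifs <;> omega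
  | arrow S T ihS ihT =>
    intro n c h
    simp only [Ty.shift, Ty.scoped, Bool.and_eq_true] at *
    exact ⟨ihS _ _ h.1, ihT _ _ h.2⟩
  | all q S T ihS ihT =>
    intro n c h
    simp only [Ty.shift, Ty.scoped, Bool.and_eq_true] at *
    exact ⟨ihS _ _ h.1, ihT _ _ h.2⟩

theorem Ty.scoped_subst (T : Ty) : ∀ n c U, c ≤ n → U.scoped n = true → T.scoped (n + 1) = true →
    (Ty.subst c U T).scoped n = true := by
  induction T with
  | top => intros; rfl
  | var i =>
    intro n c U hc hU h
    simp only [Ty.subst]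
    simp only [Ty.scoped, decide_eq_true_eq] at h
    split_ifs
    · simp only [Ty.scoped, decide_eq_true_eq]; omega
    · exact hU
    · simp only [Ty.scoped, decide_eq_true_eq]; omega
  | arrow S T ihS ihT =>
    intro n c U hc hU h
    simp only [Ty.subst, Ty.scoped, Bool.and_eq_true] at *
    exact ⟨ihS _ _ _ hc hU h.1, ihT _ _ _ hc hU h.2⟩
  | all q S T ihS ihT =>
    intro n c U hc hU h
    simp only [Ty.subst, Ty.scoped, Bool.and_eq_true] at *
    exact ⟨ihS _ _ _ hc hU h.1, ihT _ _ _ (Nat.succ_le_succ hc) (U.scoped_shift _ _ hU) h.2⟩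

/-! ### Well-formedness -/

theorem check_ty {Θ : Ctx} {S : Ty} :
    Ctx.check (.ty S :: Θ) = true ↔ Ctx.check Θ = true ∧ S.scoped Θ.numTy = true := by
  simp [Ctx.check]

theorem check_tm {Θ : Ctx} {S : Ty} :
    Ctx.check (.tm S :: Θ) = true ↔ Ctx.check Θ = true ∧ S.scoped Θ.numTy = true := by
  simp [Ctx.check]

theorem wfCheck_iff {Θ : Ctx} {T : Ty} :
    wfCheck Θ T = true ↔ Ctx.check Θ = true ∧ T.scoped Θ.numTy = true := by
  simp [wfCheck]

theorem Wf.check {Θ T} (h : Wf Θ T) : Ctx.check Θ = true ∧ T.scoped Θ.numTy = true := by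
  induction h with
  | nil => exact ⟨rfl, rfl⟩
  | weakTy _ _ ihS ihT => exact ⟨check_ty.2 ihS, Ty.scoped_shift _ _ _ ihT.2⟩
  | weakTm _ _ ihS ihT => exact ⟨check_tm.2 ihS, ihT.2⟩
  | var _ ih => exact ⟨ih.1, by simp [Ty.scoped, Ctx.numTy]⟩
  | arrow _ _ ihS ihT => exact ⟨ihS.1, by simp [Ty.scoped, ihS.2, ihT.2]⟩
  | all _ ih =>
    have := check_ty.1 ih.1
    exact ⟨this.1, by simpa [Ty.scoped, this.2, Ctx.numTy] using ih.2⟩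

/-- Every entry of the context is derivably well-formed over the older part of the context. -/
def Ctx.Built : Ctx → Prop
  | [] => True
  | .ty S :: Θ => Wf Θ S ∧ Ctx.Built Θ
  | .tm S :: Θ => Wf Θ S ∧ Ctx.Built Θ

/-- Over a nonempty context, `⊤` and the older variables are reached only by weakening, and
weakening demands a derivation for the entry that is passed over. `Built` stores these derivations.
-/
theorem Ctx.Built.wf_top : ∀ {Θ : Ctx}, Ctx.Built Θ → Wf Θ .top
  | [], _ => .nil
  | .ty _ :: _, h => .weakTy (T := .top) h.1 (Ctx.Built.wf_top h.2)
  | .tm _ :: _, h => .weakTm h.1 (Ctx.Built.wf_top h.2)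

theorem Ctx.Built.wf_var : ∀ {Θ : Ctx} {i : ℕ}, Ctx.Built Θ → i < Θ.numTy → Wf Θ (.var i)
  | [], _, _, hi => absurd hi (Nat.not_lt_zero _)
  | .ty _ :: _, 0, h, _ => .var (Ctx.Built.wf_top h)
  | .ty _ :: _, i + 1, h, hi =>
    .weakTy (T := .var i) h.1 (Ctx.Built.wf_var h.2 (Nat.lt_of_succ_lt_succ hi))
  | .tm _ :: _, _, h, hi => .weakTm h.1 (Ctx.Built.wf_var h.2 hi)

theorem Ctx.Built.wf (T : Ty) : ∀ {Θ : Ctx}, Ctx.Built Θ → T.scoped Θ.numTy = true → Wf Θ T := by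
  induction T with
  | top => intro Θ h _; exact h.wf_top
  | var i => intro Θ h hi; exact h.wf_var (by simpa [Ty.scoped] using hi)
  | arrow S T ihS ihT =>
    intro Θ h hT
    simp only [Ty.scoped, Bool.and_eq_true] at hT
    exact .arrow (ihS h hT.1) (ihT h hT.2)
  | all q S T ihS ihT =>
    intro Θ h hT
    simp only [Ty.scoped, Bool.and_eq_true] at hT
    exact .all (ihT (Θ := .ty S :: Θ) ⟨ihS h hT.1, h⟩ hT.2)

theorem Ctx.built_of_check : ∀ {Θ : Ctx}, Ctx.check Θ = true → Ctx.Built Θ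
  | [], _ => trivial
  | .ty S :: _, h =>
    have h' := check_ty.1 h
    ⟨(Ctx.built_of_check h'.1).wf S h'.2, Ctx.built_of_check h'.1⟩
  | .tm S :: _, h =>
    have h' := check_tm.1 h
    ⟨(Ctx.built_of_check h'.1).wf S h'.2, Ctx.built_of_check h'.1⟩

/-- Well-formedness is a matter of scoping alone. The Boolean form is the one that can be inverted
by simplification. -/
theorem wf_iff {Θ : Ctx} {T : Ty} : Wf Θ T ↔ Ctx.check Θ = true ∧ T.scoped Θ.numTy = true :=
  ⟨Wf.check, fun h => (Ctx.built_of_check h.1).wf T h.2⟩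

theorem wf_top_iff {Θ : Ctx} : Wf Θ .top ↔ Ctx.check Θ = true :=
  wf_iff.trans (and_iff_left rfl)

theorem wf_iff_wfCheck {Θ : Ctx} {T : Ty} : Wf Θ T ↔ wfCheck Θ T = true :=
  wf_iff.trans wfCheck_iff.symm

theorem bound_scoped : ∀ {Θ : Ctx} {i : ℕ} {T : Ty}, Ctx.check Θ = true →
    Ctx.bound Θ i = some T → i < Θ.numTy ∧ T.scoped Θ.numTy = true
  | [], _, _, _, h => by simp [Ctx.bound] at h
  | .tm _ :: Θ, _, _, hΘ, h => bound_scoped (Θ := Θ) (check_tm.1 hΘ).1 h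
  | .ty S :: Θ, 0, T, hΘ, h => by
    simp only [Ctx.bound, Option.some.injEq] at h
    subst h
    exact ⟨Nat.succ_pos _, S.scoped_shift _ _ (check_ty.1 hΘ).2⟩
  | .ty S :: Θ, i + 1, T, hΘ, h => by
    simp only [Ctx.bound, Option.map_eq_some_iff] at h
    obtain ⟨A, hA, rfl⟩ := h
    have := bound_scoped (check_ty.1 hΘ).1 hA
    exact ⟨Nat.succ_lt_succ this.1, A.scoped_shift _ _ this.2⟩

theorem exists_bound : ∀ {Θ : Ctx} {i : ℕ}, i < Θ.numTy → ∃ T, Ctx.bound Θ i = some T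
  | [], _, h => absurd h (Nat.not_lt_zero _)
  | .tm _ :: Θ, _, h => exists_bound (Θ := Θ) h
  | .ty S :: _, 0, _ => ⟨S.shift 0, rfl⟩
  | .ty _ :: Θ, i + 1, h => by
    obtain ⟨T, hT⟩ := exists_bound (Θ := Θ) (Nat.lt_of_succ_lt_succ h)
    exact ⟨T.shift 0, by simp [Ctx.bound, hT]⟩

theorem type_scoped : ∀ {Θ : Ctx} {i : ℕ} {T : Ty}, Ctx.check Θ = true →
    Ctx.type Θ i = some T → T.scoped Θ.numTy = true
  | [], _, _, _, h => by simp [Ctx.type] at h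
  | .ty _ :: Θ, i, T, hΘ, h => by
    simp only [Ctx.type, Option.map_eq_some_iff] at h
    obtain ⟨A, hA, rfl⟩ := h
    exact A.scoped_shift _ _ (type_scoped (check_ty.1 hΘ).1 hA)
  | .tm S :: Θ, 0, T, hΘ, h => by
    simp only [Ctx.type, Option.some.injEq] at h
    subst h
    exact (check_tm.1 hΘ).2
  | .tm _ :: Θ, i + 1, _, hΘ, h => type_scoped (Θ := Θ) (check_tm.1 hΘ).1 h


/-! ### Declarative subtyping: weakening and substitution -/

theorem Sub.wf {Θ S T} (h : Sub Θ S T) :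
    Ctx.check Θ = true ∧ S.scoped Θ.numTy = true ∧ T.scoped Θ.numTy = true := by
  induction h with
  | var hΘ hb =>
    have := bound_scoped (wf_top_iff.1 hΘ) hb
    exact ⟨wf_top_iff.1 hΘ, by simpa [Ty.scoped] using this.1, this.2⟩
  | top h => exact ⟨h.check.1, h.check.2, rfl⟩
  | refl h => exact ⟨h.check.1, h.check.2, h.check.2⟩
  | trans _ _ ih₁ ih₂ => exact ⟨ih₁.1, ih₁.2.1, ih₂.2.2⟩
  | arrow _ _ ih₁ ih₂ => simp [Ty.scoped, ih₁, ih₂]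
  | allFun _ ih =>
    have := check_ty.1 ih.1
    have h1 := ih.2.1
    have h2 := ih.2.2
    simp only [Ctx.numTy] at h1 h2
    simp [Ty.scoped, this, h1, h2]
  | allLoc _ _ ih₁ ih₂ =>
    have h1 := ih₂.2.1
    have h2 := ih₂.2.2
    simp only [Ctx.numTy] at h1 h2
    simp [Ty.scoped, ih₁, h1, h2]
  | allTop _ _ ih₁ ih₂ =>
    have h1 := ih₂.2.1
    have h2 := ih₂.2.2
    simp only [Ctx.numTy] at h1 h2
    simp [Ty.scoped, ih₁, h1, h2]

/-- `Δ` extends `Θ` by a type variable with index `c`. -/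
structure Weakens (c : ℕ) (Θ Δ : Ctx) : Prop where
  check : Ctx.check Δ = true
  numTy : Δ.numTy = Θ.numTy + 1
  bound : ∀ i T, Ctx.bound Θ i = some T →
    Ctx.bound Δ (if i < c then i else i + 1) = some (T.shift c)

theorem Weakens.scoped_shift {c Θ Δ} (h : Weakens c Θ Δ) {T : Ty} (hT : T.scoped Θ.numTy = true) :
    (T.shift c).scoped Δ.numTy = true := by
  rw [h.numTy]; exact T.scoped_shift _ _ hT

theorem Weakens.cons {c Θ Δ} (h : Weakens c Θ Δ) {S : Ty} (hS : S.scoped Θ.numTy = true) :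
    Weakens (c + 1) (.ty S :: Θ) (.ty (S.shift c) :: Δ) where
  check := check_ty.2 ⟨h.check, h.scoped_shift hS⟩
  numTy := by simp [Ctx.numTy, h.numTy]
  bound
    | 0, T, hT => by
      simp only [Ctx.bound, Option.some.injEq] at hT
      subst hT
      simp [Ctx.bound, Ty.shift_shift S 0 c]
    | i + 1, T, hT => by
      simp only [Ctx.bound, Option.map_eq_some_iff] at hT
      obtain ⟨A, hA, rfl⟩ := hT
      have := h.bound i A hA
      have e : (if i + 1 < c + 1 then i + 1 else i + 1 + 1) =
          (if i < c then i else i + 1) + 1 := by split_ifs <;> omega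
      rw [e]
      simp [Ctx.bound, this, Ty.shift_shift A 0 c]

theorem weakens_ty {Θ : Ctx} {S : Ty} (h : Ctx.check (.ty S :: Θ) = true) :
    Weakens 0 Θ (.ty S :: Θ) where
  check := h
  numTy := rfl
  bound i T hT := by simp [Ctx.bound, hT]

/-- The new variable may sit at any index `c`, because going under a binder moves it from `c` to `c
+ 1`. The context is seen only through its well-formedness, the number of its variables and its
bounds, so `Weakens` records just these. -/
theorem Sub.weaken {Θ S T} (h : Sub Θ S T) :
    ∀ {c Δ}, Weakens c Θ Δ → Sub Δ (S.shift c) (T.shift c) := by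
  induction h with
  | var _ hb => intro c Δ w; exact .var (wf_top_iff.2 w.check) (w.bound _ _ hb)
  | top h => intro c Δ w; exact .top (wf_iff.2 ⟨w.check, w.scoped_shift h.check.2⟩)
  | refl h => intro c Δ w; exact .refl (wf_iff.2 ⟨w.check, w.scoped_shift h.check.2⟩)
  | trans _ _ ih₁ ih₂ => intro c Δ w; exact .trans (ih₁ w) (ih₂ w)
  | arrow _ _ ih₁ ih₂ => intro c Δ w; exact .arrow (ih₁ w) (ih₂ w)
  | allFun h ih => intro c Δ w; exact .allFun (ih (w.cons (check_ty.1 h.wf.1).2))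
  | allLoc _ h ih₁ ih₂ =>
    intro c Δ w; exact .allLoc (ih₁ w) (ih₂ (w.cons (check_ty.1 h.wf.1).2))
  | allTop _ h ih₁ ih₂ =>
    intro c Δ w; exact .allTop (ih₁ w) (ih₂ (w.cons (S := .top) rfl))

/-- Substitution of `U` for the variable with index `c` maps types over `Θ` to types over `Δ`,
and the assumptions of `Θ` to derivable subtypings. -/
structure Substs (c : ℕ) (U : Ty) (Θ Δ : Ctx) : Prop where
  check : Ctx.check Δ = true
  numTy : Θ.numTy = Δ.numTy + 1
  le : c ≤ Δ.numTy
  scopedTy : U.scoped Δ.numTy = true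
  bound : ∀ i T, Ctx.bound Θ i = some T → Sub Δ (Ty.subst c U (.var i)) (Ty.subst c U T)

theorem Substs.scoped_subst {c U Θ Δ} (h : Substs c U Θ Δ) {T : Ty}
    (hT : T.scoped Θ.numTy = true) : (Ty.subst c U T).scoped Δ.numTy = true :=
  T.scoped_subst _ _ _ h.le h.scopedTy (h.numTy ▸ hT)

theorem Substs.cons {c U Θ Δ} (h : Substs c U Θ Δ) {S : Ty} (hS : S.scoped Θ.numTy = true) :
    Substs (c + 1) (U.shift 0) (.ty S :: Θ) (.ty (Ty.subst c U S) :: Δ) where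
  check := check_ty.2 ⟨h.check, h.scoped_subst hS⟩
  numTy := by simp [Ctx.numTy, h.numTy]
  le := Nat.succ_le_succ h.le
  scopedTy := U.scoped_shift _ _ h.scopedTy
  bound
    | 0, T, hT => by
      simp only [Ctx.bound, Option.some.injEq] at hT
      subst hT
      rw [← Ty.shift_subst S 0 c U (Nat.zero_le _)]
      refine .var (wf_top_iff.2 (check_ty.2 ⟨h.check, h.scoped_subst hS⟩)) ?_
      simp [Ctx.bound]
    | i + 1, T, hT => by
      simp only [Ctx.bound, Option.map_eq_some_iff] at hT
      obtain ⟨A, hA, rfl⟩ := hT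
      have := (h.bound i A hA).weaken (weakens_ty (check_ty.2 ⟨h.check, h.scoped_subst hS⟩))
      rw [Ty.shift_subst _ 0 c U (Nat.zero_le _), Ty.shift_subst _ 0 c U (Nat.zero_le _)] at this
      exact this

/-- An assumption `X <: S` for the substituted variable turns into `U <: S`, which `Substs` provides
as a derivation; all other rules commute with substitution. This is what keeps synthesized types
minimal at type application. -/
theorem Sub.substitute {Θ S T} (h : Sub Θ S T) :
    ∀ {c U Δ}, Substs c U Θ Δ → Sub Δ (Ty.subst c U S) (Ty.subst c U T) := by
  induction h with
  | var _ hb => intro c U Δ w; exact w.bound _ _ hb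
  | top h => intro c U Δ w; exact .top (wf_iff.2 ⟨w.check, w.scoped_subst h.check.2⟩)
  | refl h => intro c U Δ w; exact .refl (wf_iff.2 ⟨w.check, w.scoped_subst h.check.2⟩)
  | trans _ _ ih₁ ih₂ => intro c U Δ w; exact .trans (ih₁ w) (ih₂ w)
  | arrow _ _ ih₁ ih₂ => intro c U Δ w; exact .arrow (ih₁ w) (ih₂ w)
  | allFun h ih => intro c U Δ w; exact .allFun (ih (w.cons (check_ty.1 h.wf.1).2))
  | allLoc _ h ih₁ ih₂ =>
    intro c U Δ w; exact .allLoc (ih₁ w) (ih₂ (w.cons (check_ty.1 h.wf.1).2))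
  | allTop _ h ih₁ ih₂ =>
    intro c U Δ w; exact .allTop (ih₁ w) (ih₂ (w.cons (S := .top) rfl))

theorem substs_head {Θ : Ctx} {S U : Ty} (h : Sub Θ U S) : Substs 0 U (.ty S :: Θ) Θ where
  check := h.wf.1
  numTy := rfl
  le := Nat.zero_le _
  scopedTy := h.wf.2.1
  bound
    | 0, T, hT => by
      simp only [Ctx.bound, Option.some.injEq] at hT
      subst hT
      rw [Ty.subst_shift]
      exact h
    | i + 1, T, hT => by
      simp only [Ctx.bound, Option.map_eq_some_iff] at hT
      obtain ⟨A, hA, rfl⟩ := hT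
      rw [Ty.subst_shift]
      exact .var (wf_top_iff.2 h.wf.1) hA

/-! ### Algorithmic subtyping as an inductive relation -/

/-- Derivability by the algorithmic subtyping rules. -/
inductive ASub : Ctx → Ty → Ty → Prop
  | top {Θ T} : wfCheck Θ T = true → ASub Θ T .top
  | refl {Θ i} : wfCheck Θ (.var i) = true → ASub Θ (.var i) (.var i)
  | var {Θ i S T} : Ctx.bound Θ i = some S → ASub Θ S T → ASub Θ (.var i) T
  | arrow {Θ S S' T T'} : ASub Θ S' S → ASub Θ T T' → ASub Θ (.arrow S T) (.arrow S' T')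
  | allFun {Θ S T T'} : ASub (.ty S :: Θ) T T' → ASub Θ (.all .K S T) (.all .K S T')
  | allLoc {Θ S₀ S₁ T₀ T₁} : ASub Θ T₀ S₀ → ASub (.ty S₀ :: Θ) S₁ T₁ →
      ASub Θ (.all .K S₀ S₁) (.all .top T₀ T₁)
  | allTop {Θ S₀ S₁ T₀ T₁} : ASub Θ T₀ S₀ → ASub (.ty .top :: Θ) S₁ T₁ →
      ASub Θ (.all .top S₀ S₁) (.all .top T₀ T₁)

/-- Only the leaves of a derivation test well-formedness. Every derivation has a leaf, and the
context only grows on the way to it. -/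
theorem ASub.check {Θ S T} (h : ASub Θ S T) : Ctx.check Θ = true := by
  induction h with
  | top h => exact (wfCheck_iff.1 h).1
  | refl h => exact (wfCheck_iff.1 h).1
  | var _ _ ih => exact ih
  | arrow _ _ ih _ => exact ih
  | allFun _ ih => exact (check_ty.1 ih).1
  | allLoc _ _ ih _ => exact ih
  | allTop _ _ ih _ => exact ih

theorem ASub.sub {Θ S T} (h : ASub Θ S T) : Sub Θ S T := by
  induction h with
  | top h => exact .top (wf_iff_wfCheck.2 h)
  | refl h => exact .refl (wf_iff_wfCheck.2 h)
  | var hb h ih => exact .trans (.var (wf_top_iff.2 h.check) hb) ih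
  | arrow _ _ ih₁ ih₂ => exact .arrow ih₁ ih₂
  | allFun _ ih => exact .allFun ih
  | allLoc _ _ ih₁ ih₂ => exact .allLoc ih₁ ih₂
  | allTop _ _ ih₁ ih₂ => exact .allTop ih₁ ih₂

theorem ASub.wfCheck_left {Θ S T} (h : ASub Θ S T) : wfCheck Θ S = true :=
  wfCheck_iff.2 ⟨h.check, h.sub.wf.2.1⟩

theorem ASub.wfCheck_right {Θ S T} (h : ASub Θ S T) : wfCheck Θ T = true :=
  wfCheck_iff.2 ⟨h.check, h.sub.wf.2.2⟩

/-! ### Reflexivity, narrowing and transitivity of algorithmic subtyping. -/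

theorem ASub.refl_of_scoped (T : Ty) : ∀ {Θ : Ctx}, Ctx.check Θ = true →
    T.scoped Θ.numTy = true → ASub Θ T T := by
  induction T with
  | top => intro Θ hΘ h; exact .top (wfCheck_iff.2 ⟨hΘ, h⟩)
  | var i => intro Θ hΘ h; exact .refl (wfCheck_iff.2 ⟨hΘ, h⟩)
  | arrow S T ihS ihT =>
    intro Θ hΘ h
    simp only [Ty.scoped, Bool.and_eq_true] at h
    exact .arrow (ihS hΘ h.1) (ihT hΘ h.2)
  | all q S T ihS ihT =>
    intro Θ hΘ h
    simp only [Ty.scoped, Bool.and_eq_true] at h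
    cases q with
    | K => exact .allFun (ihT (check_ty.2 ⟨hΘ, h.1⟩) h.2)
    | top => exact .allTop (ihS hΘ h.1) (ihT (check_ty.2 ⟨hΘ, rfl⟩) h.2)

/-- `Δ` declares the same type variables as `Θ`, except that some bounds `⊤` are replaced. -/
structure Narrows (Θ Δ : Ctx) : Prop where
  check : Ctx.check Δ = true
  numTy : Δ.numTy = Θ.numTy
  bound : ∀ i T, Ctx.bound Θ i = some T → T = .top ∨ Ctx.bound Δ i = some T

theorem Narrows.cons {Θ Δ} (h : Narrows Θ Δ) {S : Ty} (hS : S.scoped Θ.numTy = true) :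
    Narrows (.ty S :: Θ) (.ty S :: Δ) where
  check := check_ty.2 ⟨h.check, h.numTy ▸ hS⟩
  numTy := by simp [Ctx.numTy, h.numTy]
  bound
    | 0, T, hT => .inr hT
    | i + 1, T, hT => by
      simp only [Ctx.bound, Option.map_eq_some_iff] at hT
      obtain ⟨A, hA, rfl⟩ := hT
      rcases h.bound i A hA with rfl | h
      · exact .inl rfl
      · exact .inr (by simp [Ctx.bound, h])

theorem Narrows.wfCheck {Θ Δ} (h : Narrows Θ Δ) {T : Ty} (hT : wfCheck Θ T = true) :
    wfCheck Δ T = true :=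
  wfCheck_iff.2 ⟨h.check, h.numTy ▸ (wfCheck_iff.1 hT).2⟩

/-- If a variable with bound `⊤` is promoted, the rest of the derivation has `⊤` on its left and so
must be the rule for `⊤` on the right. That rule applies directly to the variable, whatever its new
bound. Unlike general narrowing, this does not depend on transitivity. -/
theorem ASub.narrow {Θ S T} (h : ASub Θ S T) : ∀ {Δ}, Narrows Θ Δ → ASub Δ S T := by
  induction h with
  | top h => intro Δ w; exact .top (w.wfCheck h)
  | refl h => intro Δ w; exact .refl (w.wfCheck h)
  | var hb h ih =>
    intro Δ w
    rcases w.bound _ _ hb with rfl | hb'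
    · cases h
      exact .top (w.wfCheck (ASub.var hb (.top ‹_›)).wfCheck_left)
    · exact .var hb' (ih w)
  | arrow _ _ ih₁ ih₂ => intro Δ w; exact .arrow (ih₁ w) (ih₂ w)
  | allFun h ih => intro Δ w; exact .allFun (ih (w.cons (check_ty.1 h.check).2))
  | allLoc _ h ih₁ ih₂ => intro Δ w; exact .allLoc (ih₁ w) (ih₂ (w.cons (check_ty.1 h.check).2))
  | allTop _ h ih₁ ih₂ => intro Δ w; exact .allTop (ih₁ w) (ih₂ (w.cons (S := .top) rfl))

theorem narrows_top {Θ : Ctx} {S : Ty} (h : Ctx.check (.ty S :: Θ) = true) :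
    Narrows (.ty .top :: Θ) (.ty S :: Θ) where
  check := h
  numTy := rfl
  bound
    | 0, T, hT => .inl (by simpa [Ctx.bound, Ty.shift] using hT.symm)
    | _ + 1, _, hT => .inr hT

theorem narrows_tm {Θ : Ctx} {S : Ty} (h : Ctx.check Θ = true) : Narrows (.tm S :: Θ) Θ where
  check := h
  numTy := rfl
  bound _ _ hT := .inr hT

/-- Outer induction on the size of the middle type, inner induction on the first derivation.
Promotion of a variable on the far left keeps the middle type and is handled by the inner induction;
matching structural rules pass to components of the middle type, also where the order of the two
derivations is reversed. -/
theorem ASub.trans_of_size : ∀ (n : ℕ) {Θ S Q T}, sizeOf Q < n → ASub Θ S Q → ASub Θ Q T →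
    ASub Θ S T := by
  intro n
  induction n with
  | zero => intro _ _ _ _ h; exact absurd h (Nat.not_lt_zero _)
  | succ n IH =>
    intro Θ S Q T hn h₁
    induction h₁ generalizing T with
    | top h =>
      intro h₂
      cases h₂
      exact .top h
    | refl h => exact id
    | var hb _ ih => intro h₂; exact .var hb (ih hn h₂)
    | arrow a b =>
      intro h₂
      simp only [Ty.arrow.sizeOf_spec] at hn
      cases h₂ with
      | top _ => exact .top (ASub.arrow a b).wfCheck_left
      | arrow c d => exact .arrow (IH (by omega) c a) (IH (by omega) b d)
    | allFun a =>
      intro h₂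
      simp only [Ty.all.sizeOf_spec] at hn
      cases h₂ with
      | top _ => exact .top (ASub.allFun a).wfCheck_left
      | allFun c => exact .allFun (IH (by omega) a c)
      | allLoc c d => exact .allLoc c (IH (by omega) a d)
    | allLoc a b =>
      intro h₂
      simp only [Ty.all.sizeOf_spec] at hn
      cases h₂ with
      | top _ => exact .top (ASub.allLoc a b).wfCheck_left
      -- The second derivation compares bodies under the bound `⊤`, the conclusion asks for the
      -- bound of the `∀^K` type: the one place where narrowing enters.
      | allTop c d => exact .allLoc (IH (by omega) c a) (IH (by omega) b (d.narrow (narrows_top b.check)))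
    | allTop a b =>
      intro h₂
      simp only [Ty.all.sizeOf_spec] at hn
      cases h₂ with
      | top _ => exact .top (ASub.allTop a b).wfCheck_left
      | allTop c d => exact .allTop (IH (by omega) c a) (IH (by omega) b d)

theorem ASub.trans {Θ S Q T} (h₁ : ASub Θ S Q) (h₂ : ASub Θ Q T) : ASub Θ S T :=
  ASub.trans_of_size _ (Nat.lt_succ_self _) h₁ h₂

theorem Sub.asub {Θ S T} (h : Sub Θ S T) : ASub Θ S T := by
  induction h with
  | var hΘ hb =>
    exact .var hb (ASub.refl_of_scoped _ (wf_top_iff.1 hΘ) (bound_scoped (wf_top_iff.1 hΘ) hb).2)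
  | top h => exact .top (wf_iff_wfCheck.1 h)
  | refl h => exact ASub.refl_of_scoped _ h.check.1 h.check.2
  | trans _ _ ih₁ ih₂ => exact ih₁.trans ih₂
  | arrow _ _ ih₁ ih₂ => exact .arrow ih₁ ih₂
  | allFun _ ih => exact .allFun ih
  | allLoc _ _ ih₁ ih₂ => exact .allLoc ih₁ ih₂
  | allTop _ _ ih₁ ih₂ => exact .allTop ih₁ ih₂


/-! ### Runs with bounded recursion depth -/

theorem Returns.const {α : Type} (a : α) : Returns (fun _ => some a) a := ⟨0, fun _ _ => rfl⟩

theorem Returns.unique {α : Type} {f : ℕ → Option α} {a b : α} (ha : Returns f a)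
    (hb : Returns f b) : a = b := by
  obtain ⟨N, hN⟩ := ha
  obtain ⟨M, hM⟩ := hb
  have := (hN (max N M) (le_max_left _ _)).symm.trans (hM (max N M) (le_max_right _ _))
  exact Option.some.inj this

theorem Returns.succ {α : Type} {f g : ℕ → Option α} {a : α} (h : ∀ n, f (n + 1) = g n)
    (hg : Returns g a) : Returns f a := by
  obtain ⟨N, hN⟩ := hg
  refine ⟨N + 1, fun n hn => ?_⟩
  obtain ⟨m, rfl⟩ : ∃ m, n = m + 1 := ⟨n - 1, by omega⟩
  rw [h]
  exact hN m (by omega)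

theorem Returns.map {α β : Type} {f : ℕ → Option α} {a : α} (g : α → β) (hf : Returns f a) :
    Returns (fun n => (f n).map g) (g a) := by
  obtain ⟨N, hN⟩ := hf
  exact ⟨N, fun n hn => by simp [hN n hn]⟩

theorem Returns.bind {α β : Type} {f : ℕ → Option α} {a : α} {g : ℕ → α → Option β} {b : β}
    (hf : Returns f a) (hg : Returns (fun n => g n a) b) :
    Returns (fun n => (f n).bind (g n)) b := by
  obtain ⟨N, hN⟩ := hf
  obtain ⟨M, hM⟩ := hg
  refine ⟨max N M, fun n hn => ?_⟩
  simp only [hN n (le_trans (le_max_left _ _) hn), Option.bind_some]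
  exact hM n (le_trans (le_max_right _ _) hn)

theorem Returns.both {f g : ℕ → Option Bool} {a b : Bool} (hf : Returns f a) (hg : Returns g b) :
    Returns (fun n => both (f n) (g n)) (a && b) :=
  hf.bind (g := fun n a => (g n).map fun b => a && b) (hg.map _)

/-! ### The subtyping algorithm -/

theorem subtype_top (n : ℕ) (Θ : Ctx) (S : Ty) :
    subtype (n + 1) Θ S .top = some (wfCheck Θ S) := by
  cases S <;> rfl

theorem subtype_var (n : ℕ) (Θ : Ctx) (i : ℕ) (T : Ty) (hT : T ≠ .top) :
    subtype (n + 1) Θ (.var i) T =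
      if T = .var i then some (wfCheck Θ (.var i))
      else match Ctx.bound Θ i with
        | some S => subtype n Θ S T
        | none => some false := by
  cases T with
  | top => exact absurd rfl hT
  | _ => rfl

theorem subtype_allFun (n : ℕ) (Θ : Ctx) (S T S' T' : Ty) :
    subtype (n + 1) Θ (.all .K S T) (.all .K S' T') =
      if S = S' then subtype n (.ty S :: Θ) T T' else some false := rfl

theorem both_eq_some_true {x y : Option Bool} :
    both x y = some true ↔ x = some true ∧ y = some true := by
  rcases x with _ | _ | _ <;> rcases y with _ | _ | _ <;> simp [both]

theorem asub_of_subtype : ∀ (n : ℕ) {Θ : Ctx} {S T : Ty}, subtype n Θ S T = some true → ASub Θ S T := by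
  intro n
  induction n with
  | zero => intro Θ S T h; simp [subtype] at h
  | succ n ih =>
    intro Θ S T h
    by_cases hT : T = .top
    · subst hT
      rw [subtype_top] at h
      exact .top (Option.some.inj h)
    cases S with
    | top => cases T <;> simp [subtype] at h hT
    | var i =>
      rw [subtype_var _ _ _ _ hT] at h
      split_ifs at h with h1
      · subst h1
        exact .refl (Option.some.inj h)
      · split at h
        · exact .var ‹_› (ih h)
        · cases h
    | arrow A B =>
      cases T with
      | arrow C D =>
        have h := both_eq_some_true.1 h
        exact .arrow (ih h.1) (ih h.2)
      | top => exact absurd rfl hT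
      | var => simp [subtype] at h
      | all q => simp [subtype] at h
    | all q A B =>
      cases T with
      | top => exact absurd rfl hT
      | var => cases q <;> simp [subtype] at h
      | arrow => cases q <;> simp [subtype] at h
      | all q' C D =>
        cases q <;> cases q'
        · rw [subtype_allFun] at h
          split_ifs at h with h1
          · subst h1
            exact .allFun (ih h)
          · cases h
        · have h := both_eq_some_true.1 h
          exact .allLoc (ih h.1) (ih h.2)
        · simp [subtype] at h
        · have h := both_eq_some_true.1 h
          exact .allTop (ih h.1) (ih h.2)

theorem ASub.returns {Θ S T} (h : ASub Θ S T) : Returns (fun n => subtype n Θ S T) true := by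
  induction h with
  | top h => exact .succ (fun n => (subtype_top n _ _).trans (congrArg some h)) (.const true)
  | refl h =>
    refine .succ (fun n => ?_) (.const true)
    rw [subtype_var _ _ _ _ (by simp), if_pos rfl, h]
  | @var Θ i S T hb h ih =>
    -- The relation permits promotion of a variable even when the right side is `⊤` or that same
    -- variable, where the algorithm stops at once. In both cases it accepts, since the left side is
    -- well-formed.
    by_cases hT : T = .top
    · subst hT
      refine .succ (fun n => (subtype_top n _ _).trans (congrArg some ?_)) (.const true)
      exact (ASub.var hb h).wfCheck_left
    by_cases hi : T = .var i
    · subst hi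
      refine .succ (fun n => ?_) (.const true)
      rw [subtype_var _ _ _ _ hT, if_pos rfl, (ASub.var hb h).wfCheck_left]
    · refine .succ (fun n => ?_) ih
      rw [subtype_var _ _ _ _ hT, if_neg hi, hb]
  | arrow _ _ ih₁ ih₂ => exact .succ (fun _ => rfl) (ih₁.both ih₂)
  | allFun _ ih => exact .succ (fun n => (subtype_allFun n _ _ _ _ _).trans (if_pos rfl)) ih
  | allLoc _ _ ih₁ ih₂ => exact .succ (fun _ => rfl) (ih₁.both ih₂)
  | allTop _ _ ih₁ ih₂ => exact .succ (fun _ => rfl) (ih₁.both ih₂)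

theorem both_mono {x y x' y' : Option Bool} {b : Bool} (hx : ∀ a, x = some a → x' = some a)
    (hy : ∀ a, y = some a → y' = some a) (h : both x y = some b) : both x' y' = some b := by
  rcases x with _ | x
  · cases h
  rcases y with _ | y
  · cases h
  rw [hx x rfl, hy y rfl]
  exact h

/-- More depth never changes an answer; it only completes unfinished runs. The final search over
depths relies on this. -/
theorem subtype_succ : ∀ (n : ℕ) {Θ : Ctx} {S T : Ty} {b : Bool},
    subtype n Θ S T = some b → subtype (n + 1) Θ S T = some b := by
  intro n
  induction n with
  | zero => intro Θ S T b h; simp [subtype] at h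
  | succ n ih =>
    intro Θ S T b h
    by_cases hT : T = .top
    · subst hT
      rwa [subtype_top] at h ⊢
    cases S with
    | top => cases T <;> exact h
    | var i =>
      rw [subtype_var _ _ _ _ hT] at h ⊢
      split_ifs at h ⊢ with h1
      · exact h
      · split at h
        · exact ih h
        · exact h
    | arrow A B =>
      cases T with
      | arrow C D => exact both_mono (fun _ => ih) (fun _ => ih) h
      | top => exact absurd rfl hT
      | var => exact h
      | all q => exact h
    | all q A B =>
      cases T with
      | top => exact absurd rfl hT
      | var => cases q <;> exact h
      | arrow => cases q <;> exact h
      | all q' C D =>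
        cases q <;> cases q'
        · rw [subtype_allFun] at h ⊢
          split_ifs at h ⊢ with h1
          · exact ih h
          · exact h
        · exact both_mono (fun _ => ih) (fun _ => ih) h
        · exact h
        · exact both_mono (fun _ => ih) (fun _ => ih) h

theorem subtype_mono {m n : ℕ} (hmn : m ≤ n) {Θ : Ctx} {S T : Ty} {b : Bool}
    (h : subtype m Θ S T = some b) : subtype n Θ S T = some b := by
  induction hmn with
  | refl => exact h
  | step _ ih => exact subtype_succ _ ih

/-! ### Termination of the subtyping algorithm -/

/-- The number of kernel quantifiers in a type. -/
def Ty.numK : Ty → ℕ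
  | .top => 0
  | .var _ => 0
  | .arrow S T => S.numK + T.numK
  | .all .K S T => S.numK + T.numK + 1
  | .all .top S T => S.numK + T.numK

theorem Ty.IsFTop.numK_eq {T : Ty} (h : T.IsFTop) : T.numK = 0 := by
  induction T with
  | top => rfl
  | var => rfl
  | arrow S T ihS ihT => simp [Ty.numK, ihS h.1, ihT h.2]
  | all q S T ihS ihT =>
    obtain ⟨rfl, hS, hT⟩ := h
    simp [Ty.numK, ihS hS, ihT hT]

/-- Extend an assignment of weights to the type variables by a weight for a new variable. -/
def consWeight (w : ℕ) (ρ : ℕ → ℕ) : ℕ → ℕ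
  | 0 => w
  | i + 1 => ρ i

/-- The size of a type in which each free variable `i` counts as `ρ i`, and each bound variable as a
variable with bound `⊤`. -/
def Ty.weight : (ℕ → ℕ) → Ty → ℕ
  | _, .top => 0
  | ρ, .var i => ρ i
  | ρ, .arrow S T => S.weight ρ + T.weight ρ + 1
  | ρ, .all _ S T => S.weight ρ + T.weight (consWeight 1 ρ) + 1

/-- The weight of a declared variable is one more than the weight of its bound. -/
def Ctx.weight : Ctx → ℕ → ℕ
  | [] => fun _ => 0
  | .tm _ :: Θ => Ctx.weight Θ
  | .ty S :: Θ => consWeight (S.weight (Ctx.weight Θ) + 1) (Ctx.weight Θ)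

theorem Ty.weight_shift (T : Ty) : ∀ (ρ ρ' : ℕ → ℕ) (c : ℕ),
    (∀ i, ρ' (if i < c then i else i + 1) = ρ i) → (T.shift c).weight ρ' = T.weight ρ := by
  induction T with
  | top => intros; rfl
  | var i => intro ρ ρ' c h; exact h i
  | arrow S T ihS ihT => intro ρ ρ' c h; simp only [Ty.shift, Ty.weight, ihS _ _ _ h, ihT _ _ _ h]
  | all q S T ihS ihT =>
    intro ρ ρ' c h
    simp only [Ty.shift, Ty.weight, ihS _ _ _ h]
    rw [ihT (consWeight 1 ρ) (consWeight 1 ρ') (c + 1)]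
    rintro (_ | i)
    · rfl
    · have e : (if i + 1 < c + 1 then i + 1 else i + 1 + 1) =
          (if i < c then i else i + 1) + 1 := by split_ifs <;> omega
      rw [e]
      exact h i

/-- Promotion of a variable lowers the weight by exactly one. -/
theorem weight_bound : ∀ {Θ : Ctx} {i : ℕ} {T : Ty}, Ctx.bound Θ i = some T →
    Ctx.weight Θ i = T.weight (Ctx.weight Θ) + 1
  | [], _, _, h => by simp [Ctx.bound] at h
  | .tm _ :: Θ, _, _, h => weight_bound (Θ := Θ) h
  | .ty S :: Θ, 0, T, h => by
    simp only [Ctx.bound, Option.some.injEq] at h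
    subst h
    rw [S.weight_shift (Ctx.weight Θ) _ 0 fun i => rfl]
    rfl
  | .ty S :: Θ, i + 1, T, h => by
    simp only [Ctx.bound, Option.map_eq_some_iff] at h
    obtain ⟨A, hA, rfl⟩ := h
    rw [A.weight_shift (Ctx.weight Θ) _ 0 fun i => rfl]
    exact weight_bound hA

theorem Ty.IsFTop.shift {T : Ty} (h : T.IsFTop) (c : ℕ) : (T.shift c).IsFTop := by
  induction T generalizing c with
  | top => trivial
  | var => trivial
  | arrow S T ihS ihT => exact ⟨ihS h.1 c, ihT h.2 c⟩
  | all q S T ihS ihT => exact ⟨h.1, ihS h.2.1 c, ihT h.2.2 (c + 1)⟩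

theorem Ty.IsFTop.subst {T : Ty} (h : T.IsFTop) (c : ℕ) {U : Ty} (hU : U.IsFTop) :
    (Ty.subst c U T).IsFTop := by
  induction T generalizing c U with
  | top => trivial
  | var => simp only [Ty.subst]; split_ifs <;> first | exact hU | trivial
  | arrow S T ihS ihT => exact ⟨ihS h.1 c hU, ihT h.2 c hU⟩
  | all q S T ihS ihT => exact ⟨h.1, ihS h.2.1 c hU, ihT h.2.2 (c + 1) (hU.shift 0)⟩

theorem Ctx.IsFTop.bound : ∀ {Θ : Ctx} {i : ℕ} {T : Ty}, Ctx.IsFTop Θ →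
    Ctx.bound Θ i = some T → T.IsFTop
  | [], _, _, _, h => by simp [Ctx.bound] at h
  | .tm _ :: Θ, _, _, hΘ, h => Ctx.IsFTop.bound (Θ := Θ) hΘ.2 h
  | .ty S :: Θ, 0, T, hΘ, h => by
    simp only [Ctx.bound, Option.some.injEq] at h
    subst h
    exact Ty.IsFTop.shift hΘ.1 0
  | .ty S :: Θ, i + 1, T, hΘ, h => by
    simp only [Ctx.bound, Option.map_eq_some_iff] at h
    obtain ⟨A, hA, rfl⟩ := h
    exact (Ctx.IsFTop.bound hΘ.2 hA).shift 0

theorem Ctx.IsFTop.type : ∀ {Θ : Ctx} {i : ℕ} {T : Ty}, Ctx.IsFTop Θ →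
    Ctx.type Θ i = some T → T.IsFTop
  | [], _, _, _, h => by simp [Ctx.type] at h
  | .ty _ :: Θ, i, T, hΘ, h => by
    simp only [Ctx.type, Option.map_eq_some_iff] at h
    obtain ⟨A, hA, rfl⟩ := h
    exact (Ctx.IsFTop.type hΘ.2 hA).shift 0
  | .tm S :: Θ, 0, T, hΘ, h => by
    simp only [Ctx.type, Option.some.injEq] at h
    subst h
    exact hΘ.1
  | .tm _ :: Θ, i + 1, _, hΘ, h => Ctx.IsFTop.type (Θ := Θ) hΘ.2 h

theorem Ty.IsMinimal.of_arrow {S T : Ty} (h : (Ty.arrow S T).IsMinimal) :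
    S.IsFTop ∧ T.IsMinimal := by
  cases h with
  | ftop h => exact ⟨h.1, .ftop h.2⟩
  | arrow h₁ h₂ => exact ⟨h₁, h₂⟩

theorem Ty.IsMinimal.of_all {q : Quant} {S T : Ty} (h : (Ty.all q S T).IsMinimal) :
    S.IsFTop ∧ T.IsMinimal := by
  cases h with
  | ftop h => exact ⟨h.2.1, .ftop h.2.2⟩
  | all h₁ h₂ => exact ⟨h₁, h₂⟩

theorem Ty.IsMinimal.of_allTop {S T : Ty} (h : (Ty.all .top S T).IsMinimal) :
    S.IsFTop ∧ T.IsFTop := by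
  cases h with
  | ftop h => exact h.2

/-- The outer parameter `k` bounds the number of `∀^K` on the left, the inner parameter `w` the
total weight. Because `k` is only an upper bound, a swap that brings a `∀^K`-free type to the left
stays within the same `k`. -/
theorem subtype_terminates_of_measure (k : ℕ) : ∀ (w : ℕ) {Θ : Ctx} {S T : Ty}, Ctx.IsFTop Θ →
    S.IsMinimal → T.IsFTop → S.numK ≤ k → S.weight Θ.weight + T.weight Θ.weight < w →
    Terminates fun n => subtype n Θ S T := by
  induction k using Nat.strong_induction_on with
  | _ k IHk =>
  intro w
  induction w with
  | zero => intro _ _ _ _ _ _ _ h; exact absurd h (Nat.not_lt_zero _)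
  | succ w IHw =>
    intro Θ S T hΘ hS hT hk hw
    have stuck : (∀ n, subtype (n + 1) Θ S T = some false) → Terminates fun n => subtype n Θ S T :=
      fun h => ⟨false, .succ h (.const false)⟩
    by_cases hT' : T = .top
    · subst hT'
      exact ⟨wfCheck Θ S, .succ (fun n => subtype_top n _ _) (.const _)⟩
    cases S with
    | top => exact stuck fun n => by cases T <;> first | rfl | exact absurd rfl hT'
    | var i =>
      by_cases hi : T = .var i
      · exact ⟨wfCheck Θ (.var i), .succ (fun n => by
          rw [subtype_var _ _ _ _ hT', if_pos hi]) (.const _)⟩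
      cases hb : Ctx.bound Θ i with
      | none => exact stuck fun n => by rw [subtype_var _ _ _ _ hT', if_neg hi, hb]
      | some A =>
        have hA := hΘ.bound hb
        have hwA := weight_bound hb
        simp only [Ty.weight] at hw
        obtain ⟨b, h⟩ := IHw hΘ (.ftop hA) hT (hA.numK_eq ▸ Nat.zero_le _)
          (show A.weight Θ.weight + T.weight Θ.weight < w by omega)
        exact ⟨b, .succ (fun n => by rw [subtype_var _ _ _ _ hT', if_neg hi, hb]) h⟩
    | arrow A B =>
      cases T with
      | top => exact absurd rfl hT'
      | var => exact stuck fun _ => rfl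
      | all => exact stuck fun _ => rfl
      | arrow C D =>
        have hA := hS.of_arrow
        simp only [Ty.weight] at hw
        simp only [Ty.numK] at hk
        -- The swapped goal is again of the required form, since the domain of a minimal arrow type
        -- is free of `∀^K`.
        obtain ⟨a, ha⟩ := IHw hΘ (.ftop hT.1) hA.1 (hT.1.numK_eq ▸ Nat.zero_le _) (by omega)
        obtain ⟨b, hb⟩ := IHw hΘ hA.2 hT.2 (by omega) (by omega)
        exact ⟨a && b, .succ (fun _ => rfl) (ha.both hb)⟩
    | all q A B =>
      cases T with
      | top => exact absurd rfl hT'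
      | var => exact stuck fun _ => by cases q <;> rfl
      | arrow => exact stuck fun _ => by cases q <;> rfl
      | all q' C D =>
        obtain ⟨rfl, hC, hD⟩ := hT
        simp only [Ty.weight] at hw
        have hA := hS.of_all
        obtain ⟨a, ha⟩ := IHw hΘ (.ftop hC) hA.1 (hC.numK_eq ▸ Nat.zero_le _) (by omega)
        cases q with
        | K =>
          simp only [Ty.numK] at hk
          -- The body now sees the true bound `A` instead of `⊤`, so its weight may grow. One `∀^K`
          -- has been removed, and the outer hypothesis accepts any weight.
          obtain ⟨b, hb⟩ := IHk B.numK (by omega) _ (Θ := .ty A :: Θ) ⟨hA.1, hΘ⟩ hA.2 hD le_rfl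
            (Nat.lt_succ_self _)
          exact ⟨a && b, .succ (fun _ => rfl) (ha.both hb)⟩
        | top =>
          have hB := hS.of_allTop.2
          obtain ⟨b, hb⟩ := IHw (Θ := .ty .top :: Θ) (S := B) (T := D) ⟨trivial, hΘ⟩ (.ftop hB) hD
            (hB.numK_eq ▸ Nat.zero_le _) (by
              -- The `1` given to bound variables in `Ty.weight` is the weight of `⊤` plus one, so
              -- the bodies weigh the same in the extended context as inside the quantifiers.
              have : Ctx.weight (.ty .top :: Θ) = consWeight 1 Θ.weight := rfl
              rw [this]
              omega)
          exact ⟨a && b, .succ (fun _ => rfl) (ha.both hb)⟩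

theorem subtype_terminates {Θ : Ctx} {S T : Ty} (hΘ : Ctx.IsFTop Θ) (hS : S.IsMinimal)
    (hT : T.IsFTop) : Terminates fun n => subtype n Θ S T :=
  subtype_terminates_of_measure _ _ hΘ hS hT le_rfl (Nat.lt_succ_self _)


/-! ### The least non-atomic supertype -/

theorem expose_of_ne_var {Θ : Ctx} {T : Ty} (h : ∀ i, T ≠ .var i) : Ctx.expose Θ T = T := by
  cases T with
  | var i => exact absurd rfl (h i)
  | _ => rcases Θ with _ | ⟨_ | _, _⟩ <;> simp [Ctx.expose]

theorem expose_tm (Θ : Ctx) (S T : Ty) : Ctx.expose (.tm S :: Θ) T = Ctx.expose Θ T := by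
  cases T with
  | var i => rfl
  | _ => rw [expose_of_ne_var (by simp), expose_of_ne_var (by simp)]

theorem expose_ty (Θ : Ctx) (S T : Ty) :
    Ctx.expose (.ty S :: Θ) (T.shift 0) = (Ctx.expose Θ T).shift 0 := by
  cases T with
  | var i => rfl
  | _ =>
    rw [expose_of_ne_var (Θ := Θ) (by simp), expose_of_ne_var (by simp [Ty.shift])]

/-- `expose` recurses on the context, whereas subtyping looks a bound up through shifts. With this
equation, exposure follows the promotion steps of a derivation. -/
theorem expose_var : ∀ {Θ : Ctx} {i : ℕ} {S : Ty}, Ctx.bound Θ i = some S →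
    Ctx.expose Θ (.var i) = Ctx.expose Θ S
  | [], _, _, h => by simp [Ctx.bound] at h
  | .tm _ :: Θ, _, _, h => by
    rw [expose_tm, expose_tm]
    exact expose_var h
  | .ty S :: Θ, 0, T, h => by
    simp only [Ctx.bound, Option.some.injEq] at h
    subst h
    rw [expose_ty]
    rfl
  | .ty S :: Θ, i + 1, T, h => by
    simp only [Ctx.bound, Option.map_eq_some_iff] at h
    obtain ⟨A, hA, rfl⟩ := h
    rw [expose_ty, ← expose_var hA]
    rfl

theorem sub_expose : ∀ {Θ : Ctx} {T : Ty}, Ctx.check Θ = true → T.scoped Θ.numTy = true →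
    Sub Θ T (Ctx.expose Θ T) := by
  have key : ∀ (w : ℕ) {Θ : Ctx} {T : Ty}, T.weight Θ.weight < w → Ctx.check Θ = true →
      T.scoped Θ.numTy = true → Sub Θ T (Ctx.expose Θ T) := by
    intro w
    induction w with
    | zero => intro _ _ h; exact absurd h (Nat.not_lt_zero _)
    | succ w ih =>
      intro Θ T hw hΘ hT
      cases T with
      | var i =>
        obtain ⟨S, hS⟩ := exists_bound (Θ := Θ) (i := i) (by simpa [Ty.scoped] using hT)
        have h := weight_bound hS
        simp only [Ty.weight] at hw
        rw [expose_var hS]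
        exact .trans (.var (wf_top_iff.2 hΘ) hS) (ih (by omega) hΘ (bound_scoped hΘ hS).2)
      | _ =>
        rw [expose_of_ne_var (by simp)]
        exact .refl (wf_iff.2 ⟨hΘ, hT⟩)
  intro Θ T
  exact key _ (Nat.lt_succ_self _)

/-- A derivation with an arrow on the right is a chain of promotions followed by the arrow rule, and
exposure performs exactly that chain. -/
theorem ASub.expose_arrow {Θ R S T} (h : ASub Θ R (.arrow S T)) :
    ∃ A B, Ctx.expose Θ R = .arrow A B ∧ ASub Θ S A ∧ ASub Θ B T := by
  generalize hQ : Ty.arrow S T = Q at h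
  induction h with
  | top => cases hQ
  | refl => cases hQ
  | var hb _ ih => rw [expose_var hb]; exact ih hQ
  | arrow a b => cases hQ; exact ⟨_, _, expose_of_ne_var (by simp), a, b⟩
  | allFun => cases hQ
  | allLoc => cases hQ
  | allTop => cases hQ

/-- After the promotions, the last rule has either kind of quantifier on the left. For `∀^⊤` the
bodies were compared under `⊤`; narrowing to the bound `A` gives both cases the same form, ready for
substitution of a subtype of `A`. -/
theorem ASub.expose_allTop {Θ R S T} (h : ASub Θ R (.all .top S T)) :
    ∃ q A B, Ctx.expose Θ R = .all q A B ∧ ASub Θ S A ∧ ASub (.ty A :: Θ) B T := by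
  generalize hQ : Ty.all .top S T = Q at h
  induction h with
  | top => cases hQ
  | refl => cases hQ
  | var hb _ ih => rw [expose_var hb]; exact ih hQ
  | arrow => cases hQ
  | allFun => cases hQ
  | allLoc a b => cases hQ; exact ⟨_, _, _, expose_of_ne_var (by simp), a, b⟩
  | allTop a b =>
    cases hQ
    exact ⟨_, _, _, expose_of_ne_var (by simp), a, b.narrow (narrows_top (check_ty.2
      (wfCheck_iff.1 a.wfCheck_right)))⟩

/-! ### Minimal types -/

/-- The substituted type must itself be free of `∀^K`, because it may land in the domain of an arrow
or in a quantifier bound. -/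
theorem Ty.IsMinimal.subst {T : Ty} (h : T.IsMinimal) (c : ℕ) {U : Ty} (hU : U.IsFTop) :
    (Ty.subst c U T).IsMinimal := by
  induction h generalizing c U with
  | ftop h => exact .ftop (h.subst c hU)
  | all h _ ih => exact .all (h.subst c hU) (ih _ (hU.shift 0))
  | arrow h _ ih => exact .arrow (h.subst c hU) (ih _ hU)

theorem Ctx.IsFTop.expose_var : ∀ {Θ : Ctx} {i : ℕ}, Ctx.IsFTop Θ →
    (Ctx.expose Θ (.var i)).IsFTop
  | [], _, _ => by simp [Ctx.expose, Ty.IsFTop]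
  | .tm _ :: Θ, _, hΘ => Ctx.IsFTop.expose_var (Θ := Θ) hΘ.2
  | .ty S :: Θ, 0, hΘ => by
    have hS : (Ctx.expose Θ S).IsFTop := by
      cases S with
      | var j => exact Ctx.IsFTop.expose_var hΘ.2
      | _ => rw [expose_of_ne_var (by simp)]; exact hΘ.1
    exact hS.shift 0
  | .ty _ :: Θ, i + 1, hΘ => (Ctx.IsFTop.expose_var (Θ := Θ) (i := i) hΘ.2).shift 0

theorem Ctx.IsFTop.expose {Θ : Ctx} {T : Ty} (hΘ : Ctx.IsFTop Θ) (hT : T.IsMinimal) :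
    (Ctx.expose Θ T).IsMinimal := by
  cases T with
  | var i => exact .ftop hΘ.expose_var
  | _ => rw [expose_of_ne_var (by simp)]; exact hT

/-! ### The minimal typing algorithm -/

theorem Typing.wf {Θ t T} (h : Typing Θ t T) :
    Ctx.check Θ = true ∧ T.scoped Θ.numTy = true := by
  induction h with
  | top h => exact ⟨h.check.1, rfl⟩
  | var h hT => exact ⟨h.check.1, type_scoped h.check.1 hT⟩
  | sub _ h ih => exact ⟨ih.1, h.wf.2.2⟩
  | arrowI _ ih =>
    have := check_tm.1 ih.1
    have h := ih.2
    simp only [Ctx.numTy] at h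
    exact ⟨this.1, by simp [Ty.scoped, this.2, h]⟩
  | arrowE _ _ ih _ =>
    have h := ih.2
    simp only [Ty.scoped, Bool.and_eq_true] at h
    exact ⟨ih.1, h.2⟩
  | allI _ ih =>
    have := check_ty.1 ih.1
    have h := ih.2
    simp only [Ctx.numTy] at h
    exact ⟨this.1, by simp [Ty.scoped, this.2, h]⟩
  | allE _ hs ih =>
    have h := ih.2
    simp only [Ty.scoped, Bool.and_eq_true] at h
    exact ⟨ih.1, Ty.scoped_subst _ _ _ _ (Nat.zero_le _) hs.wf.2.1 h.2⟩

theorem typing_of_synth (n : ℕ) (t : Tm) : ∀ {Θ : Ctx} {S : Ty}, Ctx.check Θ = true →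
    synth n Θ t = some (some S) → Typing Θ t S := by
  induction t with
  | top =>
    intro Θ S hΘ h
    simp only [synth, Option.some.injEq] at h
    subst h
    exact .top (wf_top_iff.2 hΘ)
  | var i =>
    intro Θ S hΘ h
    simp only [synth, Option.some.injEq] at h
    exact .var (wf_top_iff.2 hΘ) h
  | lam A t ih =>
    intro Θ S hΘ h
    simp only [synth] at h
    split_ifs at h with hA
    · simp only [Option.map_eq_some_iff] at h
      obtain ⟨_, h, B, rfl, rfl⟩ := h
      exact .arrowI (ih (check_tm.2 (wfCheck_iff.1 hA)) h)
    · simp at h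
  | tlam A t ih =>
    intro Θ S hΘ h
    simp only [synth] at h
    split_ifs at h with hA
    · simp only [Option.map_eq_some_iff] at h
      obtain ⟨_, h, B, rfl, rfl⟩ := h
      exact .allI (ih (check_ty.2 (wfCheck_iff.1 hA)) h)
    · simp at h
  | app r s ihr ihs =>
    intro Θ S hΘ h
    simp only [synth, Option.bind_eq_some_iff] at h
    obtain ⟨_ | R, hR, h⟩ := h
    · simp at h
    simp only [Option.bind_eq_some_iff] at h
    obtain ⟨_ | S', hS', h⟩ := h
    · simp at h
    simp only at h
    split at h
    · rename_i A B he
      simp only [Option.map_eq_some_iff] at h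
      obtain ⟨b, hb, h⟩ := h
      split_ifs at h with hb'
      subst hb'
      cases h
      have hr := ihr hΘ hR
      have := sub_expose hΘ hr.wf.2
      rw [he] at this
      exact .arrowE (.sub hr this) (.sub (ihs hΘ hS') (asub_of_subtype _ hb).sub)
    · simp at h
  | tapp r U ihr =>
    intro Θ S hΘ h
    simp only [synth, Option.bind_eq_some_iff] at h
    obtain ⟨_ | R, hR, h⟩ := h
    · simp at h
    simp only at h
    split at h
    · rename_i q A B he
      simp only [Option.map_eq_some_iff] at h
      obtain ⟨b, hb, h⟩ := h
      split_ifs at h with hb'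
      subst hb'
      cases h
      have hr := ihr hΘ hR
      have h1 := sub_expose hΘ hr.wf.2
      rw [he] at h1
      have hw := h1.wf.2.2
      simp only [Ty.scoped, Bool.and_eq_true] at hw
      -- The declarative elimination rule asks for `∀^⊤`. A `∀^K` type lies below the `∀^⊤` type
      -- with the same bound and body.
      have h2 : Sub Θ (.all q A B) (.all .top A B) := by
        cases q with
        | K =>
          exact .allLoc (.refl (wf_iff.2 ⟨hΘ, hw.1⟩))
            (.refl (wf_iff.2 ⟨check_ty.2 ⟨hΘ, hw.1⟩, hw.2⟩))
        | top => exact .refl (wf_iff.2 ⟨hΘ, h1.wf.2.2⟩)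
      exact .allE (.sub hr (.trans h1 h2)) (asub_of_subtype _ hb).sub
    · simp at h

/-- Completeness and minimality together, without restriction on the quantifiers: a typable term
always gets an answer, since each subtyping test made on the way is derivable. Subsumption is
absorbed by transitivity. -/
theorem synth_of_typing {Θ t T} (h : Typing Θ t T) :
    ∃ S, Returns (fun n => synth n Θ t) (some S) ∧ ASub Θ S T := by
  induction h with
  | top h => exact ⟨.top, .const _, .top (wf_iff_wfCheck.1 h)⟩
  | @var Θ i T h hT =>
    refine ⟨T, ?_, ASub.refl_of_scoped _ h.check.1 (type_scoped h.check.1 hT)⟩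
    simp only [synth, hT]
    exact .const _
  | sub _ h ih =>
    obtain ⟨S, hS, hST⟩ := ih
    exact ⟨S, hS, hST.trans h.asub⟩
  | @arrowI Θ S t T h ih =>
    obtain ⟨S', hS', hST⟩ := ih
    have hw := check_tm.1 h.wf.1
    -- Subtyping ignores term variables, so the assumption `x : S` may be dropped from the context.
    refine ⟨.arrow S S', ?_, .arrow (ASub.refl_of_scoped _ hw.1 hw.2) (hST.narrow (narrows_tm hw.1))⟩
    simp only [synth, wfCheck_iff.2 hw, if_true]
    exact hS'.map _
  | @allI Θ S t T h ih =>
    obtain ⟨S', hS', hST⟩ := ih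
    have hw := check_ty.1 h.wf.1
    refine ⟨.all .K S S', ?_, .allFun hST⟩
    simp only [synth, wfCheck_iff.2 hw, if_true]
    exact hS'.map _
  | @arrowE Θ t s S T _ _ iht ihs =>
    obtain ⟨R, hR, hRT⟩ := iht
    obtain ⟨S', hS', hSS⟩ := ihs
    obtain ⟨A, B, he, hSA, hBT⟩ := hRT.expose_arrow
    refine ⟨B, ?_, hBT⟩
    refine hR.bind (hS'.bind ?_)
    simp only [he]
    exact (hSS.trans hSA).returns.map _
  | @allE Θ t S U T _ hU iht =>
    obtain ⟨R, hR, hRT⟩ := iht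
    obtain ⟨q, A, B, he, hSA, hBT⟩ := hRT.expose_allTop
    have hUA := hU.asub.trans hSA
    -- The declared type comes from the body `T`, the synthesized one from `B`. Since `B` lies below
    -- `T` under the bound `A`, and `U` lies below `A`, substitution preserves the inequality.
    refine ⟨Ty.subst 0 U B, ?_, (hBT.sub.substitute (substs_head hUA.sub)).asub⟩
    refine hR.bind ?_
    simp only [he]
    exact hUA.returns.map _

/-- Minimality of the output is carried along as an invariant. It makes each internal subtyping call
have a minimal type on the left and a `∀^K`-free domain or bound on the right, which is the case
where termination is known. -/
theorem synth_terminates (t : Tm) : ∀ {Θ : Ctx}, Ctx.IsFTop Θ → t.IsFTop →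
    ∃ r, Returns (fun n => synth n Θ t) r ∧ ∀ S, r = some S → S.IsMinimal := by
  induction t with
  | top => intro Θ _ _; exact ⟨_, .const _, fun S h => by cases h; exact .ftop trivial⟩
  | var i => intro Θ hΘ _; exact ⟨_, .const _, fun S h => .ftop (hΘ.type h)⟩
  | lam A t ih =>
    intro Θ hΘ ht
    simp only [synth]
    split_ifs with hA
    · obtain ⟨r, hr, hm⟩ := ih (Θ := .tm A :: Θ) ⟨ht.1, hΘ⟩ ht.2
      refine ⟨_, hr.map _, ?_⟩
      rintro S h
      obtain ⟨B, hB, rfl⟩ := Option.map_eq_some_iff.1 h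
      exact .arrow ht.1 (hm _ hB)
    · exact ⟨none, .const _, by simp⟩
  | tlam A t ih =>
    intro Θ hΘ ht
    simp only [synth]
    split_ifs with hA
    · obtain ⟨r, hr, hm⟩ := ih (Θ := .ty A :: Θ) ⟨ht.1, hΘ⟩ ht.2
      refine ⟨_, hr.map _, ?_⟩
      rintro S h
      obtain ⟨B, hB, rfl⟩ := Option.map_eq_some_iff.1 h
      exact .all ht.1 (hm _ hB)
    · exact ⟨none, .const _, by simp⟩
  | app r s ihr ihs =>
    intro Θ hΘ ht
    obtain ⟨oR, hR, hmR⟩ := ihr hΘ ht.1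
    obtain ⟨oS, hS, hmS⟩ := ihs hΘ ht.2
    simp only [synth]
    rcases oR with _ | R
    · exact ⟨none, hR.bind (.const _), by simp⟩
    rcases oS with _ | S
    · exact ⟨none, hR.bind (hS.bind (.const _)), by simp⟩
    have he := hΘ.expose (hmR R rfl)
    cases hE : Ctx.expose Θ R with
    | arrow A B =>
      rw [hE] at he
      obtain ⟨b, hb⟩ := subtype_terminates hΘ (hmS S rfl) he.of_arrow.1
      refine ⟨if b then some B else none, hR.bind (hS.bind ?_), ?_⟩
      · simp only [hE]
        exact hb.map _
      · intro U hU
        split_ifs at hU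
        cases hU
        exact he.of_arrow.2
    | _ =>
      refine ⟨none, hR.bind (hS.bind ?_), by simp⟩
      simp only [hE]
      exact .const _
  | tapp r U ihr =>
    intro Θ hΘ ht
    obtain ⟨oR, hR, hmR⟩ := ihr hΘ ht.1
    simp only [synth]
    rcases oR with _ | R
    · exact ⟨none, hR.bind (.const _), by simp⟩
    have he := hΘ.expose (hmR R rfl)
    cases hE : Ctx.expose Θ R with
    | all q A B =>
      rw [hE] at he
      obtain ⟨b, hb⟩ := subtype_terminates hΘ (.ftop ht.2) he.of_all.1
      refine ⟨if b then some (Ty.subst 0 U B) else none, hR.bind ?_, ?_⟩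
      · simp only [hE]
        exact hb.map _
      · intro V hV
        split_ifs at hV
        cases hV
        exact he.of_all.2.subst 0 ht.2
    | _ =>
      refine ⟨none, hR.bind ?_, by simp⟩
      simp only [hE]
      exact .const _

theorem synth_spec {Θ : Ctx} {t : Tm} (h : FTopTerm Θ t) :
    ∃ r : Option Ty, Returns (fun n => synth n Θ t) r ∧
      ∀ S : Ty, r = some S → Wf Θ S ∧ S.IsMinimal := by
  obtain ⟨r, hr, hm⟩ := synth_terminates t h.2.1 h.2.2
  refine ⟨r, hr, fun S hS => ⟨?_, hm S hS⟩⟩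
  obtain ⟨N, hN⟩ := hr
  subst hS
  exact wf_iff.2 (typing_of_synth N t h.1.check.1 (hN N le_rfl)).wf

/-- Acceptance is sound by subsumption from the synthesized type. Conversely, if the term has type
`T`, completeness yields an accepting run, and a run has only one result. -/
theorem typecheck_spec {Θ : Ctx} {t : Tm} {T : Ty} (ht : FTopTerm Θ t) (hT : FTopType Θ T) :
    ∃ b : Bool, Returns (fun n => typecheck n Θ t T) b ∧ (b = true ↔ Typing Θ t T) := by
  obtain ⟨r, hr, hm⟩ := synth_spec ht
  rcases r with _ | S
  · refine ⟨false, hr.bind (.const _), ?_⟩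
    simp only [Bool.false_eq_true, false_iff]
    intro h
    obtain ⟨S, hS, _⟩ := synth_of_typing h
    exact absurd (hr.unique hS) (by simp)
  · obtain ⟨b, hb⟩ := subtype_terminates hT.2.1 (hm S rfl).2 hT.2.2
    refine ⟨b, hr.bind hb, ?_, ?_⟩
    · rintro rfl
      obtain ⟨N, hN⟩ := hr
      obtain ⟨M, hM⟩ := hb
      exact .sub (typing_of_synth N t ht.1.check.1 (hN N le_rfl))
        (asub_of_subtype M (hM M le_rfl)).sub
    · intro h
      obtain ⟨S', hS', hST⟩ := synth_of_typing h
      cases hr.unique hS'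
      exact hb.unique hST.returns

/-! ### Monotonicity of synthesis and typechecking in the depth bound. -/

theorem bind_mono {α β : Type} {x x' : Option α} {f f' : α → Option β} {b : β}
    (hx : ∀ a, x = some a → x' = some a) (hf : ∀ a, f a = some b → f' a = some b)
    (h : x.bind f = some b) : x'.bind f' = some b := by
  obtain ⟨a, ha, h⟩ := Option.bind_eq_some_iff.1 h
  rw [hx a ha]
  exact hf a h

theorem map_mono {α β : Type} {x x' : Option α} {f : α → β} {b : β}
    (hx : ∀ a, x = some a → x' = some a) (h : x.map f = some b) : x'.map f = some b := by
  obtain ⟨a, ha, h⟩ := Option.map_eq_some_iff.1 h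
  rw [hx a ha]
  exact congrArg some h

theorem synth_mono {m n : ℕ} (hmn : m ≤ n) (t : Tm) : ∀ {Θ : Ctx} {r : Option Ty},
    synth m Θ t = some r → synth n Θ t = some r := by
  induction t with
  | top => intro _ _ h; exact h
  | var i => intro _ _ h; exact h
  | lam A t ih =>
    intro Θ r h
    simp only [synth] at h ⊢
    split_ifs at h ⊢
    · exact map_mono (fun _ => ih) h
    · exact h
  | tlam A t ih =>
    intro Θ r h
    simp only [synth] at h ⊢
    split_ifs at h ⊢
    · exact map_mono (fun _ => ih) h
    · exact h
  | app r s ihr ihs =>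
    intro Θ r h
    simp only [synth] at h ⊢
    refine bind_mono (fun _ => ihr) ?_ h
    rintro (_ | R) h
    · exact h
    refine bind_mono (fun _ => ihs) ?_ h
    rintro (_ | S) h
    · exact h
    dsimp only at h ⊢
    split at h
    · exact map_mono (fun _ => subtype_mono hmn) h
    · exact h
  | tapp r U ihr =>
    intro Θ r h
    simp only [synth] at h ⊢
    refine bind_mono (fun _ => ihr) ?_ h
    rintro (_ | R) h
    · exact h
    dsimp only at h ⊢
    split at h
    · exact map_mono (fun _ => subtype_mono hmn) h
    · exact h

theorem typecheck_mono {m n : ℕ} (hmn : m ≤ n) {Θ : Ctx} {t : Tm} {T : Ty} {b : Bool}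
    (h : typecheck m Θ t T = some b) : typecheck n Θ t T = some b := by
  refine bind_mono (fun _ => synth_mono hmn t) ?_ h
  rintro (_ | S) h
  · exact h
  · exact subtype_mono hmn h

end FSub

/-! ### Computable functions defined by binary recursion -/

-- Functions built from tests, pairs, options, lists and arithmetic become routine `fun_prop` goals.
-- Case distinctions are therefore written with `cond` on Boolean tests.
attribute [fun_prop] Computable

namespace FSub

section Computability

variable {α β γ δ σ : Type*} [Primcodable α] [Primcodable β] [Primcodable γ] [Primcodable δ] [Primcodable σ]

@[fun_prop]
theorem computable_id' : Computable fun a : α => a := Computable.id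

@[fun_prop]
theorem computable_const' (b : β) : Computable fun _ : α => b := Computable.const b

@[fun_prop]
theorem computable_comp' {f : β → γ} {g : α → β} (hf : Computable f) (hg : Computable g) :
    Computable fun a => f (g a) := hf.comp hg

@[fun_prop]
theorem computable_fst {f : α → β × γ} (hf : Computable f) : Computable fun a => (f a).1 :=
  Computable.fst.comp hf

@[fun_prop]
theorem computable_snd {f : α → β × γ} (hf : Computable f) : Computable fun a => (f a).2 :=
  Computable.snd.comp hf

@[fun_prop]
theorem computable_prodMk {f : α → β} {g : α → γ} (hf : Computable f) (hg : Computable g) :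
    Computable fun a => (f a, g a) := hf.pair hg

@[fun_prop]
theorem computable_cond {c : α → Bool} {f g : α → σ} (hc : Computable c) (hf : Computable f)
    (hg : Computable g) : Computable fun a => cond (c a) (f a) (g a) := Computable.cond hc hf hg

@[fun_prop]
theorem computable_and {f g : α → Bool} (hf : Computable f) (hg : Computable g) :
    Computable fun a => f a && g a := Primrec.and.to_comp.comp hf hg

@[fun_prop]
theorem computable_or {f g : α → Bool} (hf : Computable f) (hg : Computable g) :
    Computable fun a => f a || g a := Primrec.or.to_comp.comp hf hg

@[fun_prop]
theorem computable_not {f : α → Bool} (hf : Computable f) : Computable fun a => !f a :=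
  Primrec.not.to_comp.comp hf

@[fun_prop]
theorem computable_some {f : α → β} (hf : Computable f) : Computable fun a => some (f a) :=
  Computable.option_some.comp hf

@[fun_prop]
theorem computable_isSome {f : α → Option β} (hf : Computable f) :
    Computable fun a => (f a).isSome := Primrec.option_isSome.to_comp.comp hf

@[fun_prop]
theorem computable_getD {f : α → Option β} {g : α → β} (hf : Computable f) (hg : Computable g) :
    Computable fun a => (f a).getD (g a) := Computable.option_getD hf hg

@[fun_prop]
theorem computable_listCons {f : α → β} {g : α → List β} (hf : Computable f) (hg : Computable g) :
    Computable fun a => f a :: g a := Computable.list_cons.comp hf hg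

@[fun_prop]
theorem computable_listTail {f : α → List β} (hf : Computable f) : Computable fun a => (f a).tail :=
  Primrec.list_tail.to_comp.comp hf

@[fun_prop]
theorem computable_head? {f : α → List β} (hf : Computable f) : Computable fun a => (f a).head? :=
  Primrec.list_head?.to_comp.comp hf

@[fun_prop]
theorem computable_add {f g : α → ℕ} (hf : Computable f) (hg : Computable g) :
    Computable fun a => f a + g a := Primrec.nat_add.to_comp.comp hf hg

@[fun_prop]
theorem computable_sub {f g : α → ℕ} (hf : Computable f) (hg : Computable g) :
    Computable fun a => f a - g a := Primrec.nat_sub.to_comp.comp hf hg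

@[fun_prop]
theorem computable_mul {f g : α → ℕ} (hf : Computable f) (hg : Computable g) :
    Computable fun a => f a * g a := Primrec.nat_mul.to_comp.comp hf hg

@[fun_prop]
theorem computable_div {f g : α → ℕ} (hf : Computable f) (hg : Computable g) :
    Computable fun a => f a / g a := Primrec.nat_div.to_comp.comp hf hg

@[fun_prop]
theorem computable_mod {f g : α → ℕ} (hf : Computable f) (hg : Computable g) :
    Computable fun a => f a % g a := Primrec.nat_mod.to_comp.comp hf hg

@[fun_prop]
theorem computable_pair {f g : α → ℕ} (hf : Computable f) (hg : Computable g) :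
    Computable fun a => Nat.pair (f a) (g a) := Primrec₂.natPair.to_comp.comp hf hg

@[fun_prop]
theorem computable_unpair {f : α → ℕ} (hf : Computable f) :
    Computable fun a => Nat.unpair (f a) := Primrec.unpair.to_comp.comp hf

/-- Boolean comparison of natural numbers. -/
def ltB (m n : ℕ) : Bool := decide (m < n)

/-- Boolean equality. -/
def eqB {α : Type*} [DecidableEq α] (a b : α) : Bool := decide (a = b)

@[simp] theorem ltB_iff {m n : ℕ} : ltB m n = true ↔ m < n := decide_eq_true_iff

@[simp] theorem eqB_iff {α : Type*} [DecidableEq α] {a b : α} : eqB a b = true ↔ a = b :=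
  decide_eq_true_iff

@[fun_prop]
theorem computable_ltB {f g : α → ℕ} (hf : Computable f) (hg : Computable g) :
    Computable fun a => ltB (f a) (g a) :=
  (Primrec.nat_lt.decide.to_comp.comp hf hg :)

@[fun_prop]
theorem computable_eqB [DecidableEq β] {f g : α → β} (hf : Computable f) (hg : Computable g) :
    Computable fun a => eqB (f a) (g a) :=
  (Primrec.eq.decide.to_comp.comp hf hg :)

/-- A function that satisfies a computable recursion equation with two recursive calls, at arguments
of smaller measure, is computable. -/
theorem computable_of_binary_rec {f : α → σ} (μ : α → ℕ) {isLeaf : α → Bool} {l r : α → α}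
    {base : α → σ} {step : α → σ → σ → σ} (hleaf : Computable isLeaf) (hl : Computable l)
    (hr : Computable r) (hbase : Computable base)
    (hstep : Computable fun p : α × σ × σ => step p.1 p.2.1 p.2.2)
    (h₀ : ∀ a, isLeaf a = true → f a = base a)
    (h₁ : ∀ a, isLeaf a = false → μ (l a) < μ a ∧ μ (r a) < μ a ∧
      f a = step a (f (l a)) (f (r a))) : Computable f := by
  -- One unfolding of the recursion equation on encoded data, with the code `c` in place of the
  -- recursive function.
  let F : Nat.Partrec.Code → ℕ →. ℕ := fun c n =>
    (Part.ofOption (Encodable.decode (α := α) n)).bind fun a =>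
      bif isLeaf a then Part.some (Encodable.encode (base a)) else
        (c.eval (Encodable.encode (l a))).bind fun x =>
          (c.eval (Encodable.encode (r a))).bind fun y =>
            (Part.ofOption (Encodable.decode (α := σ) x)).bind fun s =>
              (Part.ofOption (Encodable.decode (α := σ) y)).bind fun t =>
                Part.some (Encodable.encode (step a s t))
  have hF : Partrec₂ F := by
    refine Partrec.bind (Computable.ofOption (Computable.decode.comp Computable.snd)) ?_
    refine Partrec.cond (hleaf.comp Computable.snd)
      (Computable.encode.comp (hbase.comp Computable.snd)).partrec ?_
    refine Partrec.bind (Nat.Partrec.Code.eval_part.comp (Computable.fst.comp Computable.fst)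
      (Computable.encode.comp (hl.comp Computable.snd))) ?_
    refine Partrec.bind (Nat.Partrec.Code.eval_part.comp
      (Computable.fst.comp (Computable.fst.comp Computable.fst))
      (Computable.encode.comp (hr.comp (Computable.snd.comp Computable.fst)))) ?_
    refine Partrec.bind (Computable.ofOption
      (Computable.decode.comp (Computable.snd.comp Computable.fst))) ?_
    refine Partrec.bind (Computable.ofOption
      (Computable.decode.comp (Computable.snd.comp Computable.fst))) ?_
    refine (Computable.encode.comp (hstep.comp (Computable.pair ?_
      (Computable.pair (Computable.snd.comp Computable.fst) Computable.snd)))).partrec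
    exact Computable.snd.comp (Computable.fst.comp (Computable.fst.comp
      (Computable.fst.comp Computable.fst)))
  -- The second recursion theorem gives a code whose evaluation is `F c`, so that the calls to `c`
  -- inside `F` are the recursive calls.
  obtain ⟨c, hc⟩ := Nat.Partrec.Code.fixed_point₂ hF
  -- The measure serves only in this induction and need not be computable.
  have key : ∀ n a, μ a < n → c.eval (Encodable.encode a) = Part.some (Encodable.encode (f a)) := by
    intro n
    induction n with
    | zero => intro a h; exact absurd h (Nat.not_lt_zero _)
    | succ n ih =>
      intro a ha
      rw [hc]
      cases hs : isLeaf a with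
      | true => simp [F, hs, h₀ a hs]
      | false =>
        obtain ⟨hl', hr', he⟩ := h₁ a hs
        simp [F, hs, ih (l a) (by omega), ih (r a) (by omega), ← he]
  refine Computable.encode_iff.1 ?_
  refine Partrec.of_eq (Nat.Partrec.Code.eval_part.comp (Computable.const c) Computable.encode)
    fun a => key _ a (Nat.lt_succ_self _)

end Computability



/-! ### Types, entries and terms as computable data -/

/-- A bijective numbering of types. -/
def Ty.num : Ty → ℕ
  | .top => 0
  | .var i => 4 * i + 1
  | .arrow S T => 4 * Nat.pair S.num T.num + 2
  | .all .K S T => 4 * Nat.pair S.num T.num + 3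
  | .all .top S T => 4 * Nat.pair S.num T.num + 4

theorem Ty.num_injective : Function.Injective Ty.num := by
  intro S
  induction S with
  | top => rintro (_ | _ | _ | ⟨_ | _, _, _⟩) h <;> simp only [Ty.num] at h <;> first | rfl | omega
  | var i =>
    rintro (_ | _ | _ | ⟨_ | _, _, _⟩) h <;> simp only [Ty.num] at h <;>
      first | omega | (congr 1; omega)
  | arrow A B ihA ihB =>
    rintro (_ | _ | ⟨C, D⟩ | ⟨_ | _, _, _⟩) h <;> simp only [Ty.num] at h <;> try omega
    have h := Nat.pair_eq_pair.1 (show Nat.pair A.num B.num = Nat.pair C.num D.num by omega)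
    rw [ihA h.1, ihB h.2]
  | all q A B ihA ihB =>
    rcases q with _ | _ <;> rintro (_ | _ | _ | ⟨_ | _, C, D⟩) h <;> simp only [Ty.num] at h <;>
      try omega
    all_goals
      have h := Nat.pair_eq_pair.1 (show Nat.pair A.num B.num = Nat.pair C.num D.num by omega)
      rw [ihA h.1, ihB h.2]

/-- Surjectivity is the reason for a second numbering beside `Ty.code`: a bijection with `ℕ`
transports the `Primcodable` structure. The residue modulo 4 of the predecessor selects the
constructor, and the quotient is smaller than the number itself. -/
theorem Ty.num_surjective : Function.Surjective Ty.num := by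
  intro n
  induction n using Nat.strong_induction_on with
  | _ n ih =>
    rcases n with _ | n
    · exact ⟨.top, rfl⟩
    obtain ⟨S, hS⟩ := ih (n / 4).unpair.1 (by have := Nat.unpair_left_le (n / 4); omega)
    obtain ⟨T, hT⟩ := ih (n / 4).unpair.2 (by have := Nat.unpair_right_le (n / 4); omega)
    have hp : Nat.pair S.num T.num = n / 4 := by rw [hS, hT, Nat.pair_unpair]
    have h4 : n % 4 = 0 ∨ n % 4 = 1 ∨ n % 4 = 2 ∨ n % 4 = 3 := by omega
    rcases h4 with h | h | h | h
    · exact ⟨.var (n / 4), by simp only [Ty.num]; omega⟩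
    · exact ⟨.arrow S T, by simp only [Ty.num, hp]; omega⟩
    · exact ⟨.all .K S T, by simp only [Ty.num, hp]; omega⟩
    · exact ⟨.all .top S T, by simp only [Ty.num, hp]; omega⟩

/-- Types correspond to natural numbers. -/
noncomputable def Ty.equivNat : Ty ≃ ℕ := Equiv.ofBijective Ty.num ⟨Ty.num_injective, Ty.num_surjective⟩

noncomputable instance : Primcodable Ty := Primcodable.ofEquiv ℕ Ty.equivNat

theorem computable_tyNum : Computable Ty.num := (Primrec.of_equiv (e := Ty.equivNat)).to_comp

theorem computable_tyOfNum : Computable Ty.equivNat.symm :=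
  (Primrec.of_equiv_symm (e := Ty.equivNat)).to_comp

@[simp] theorem Ty.equivNat_symm_num (T : Ty) : Ty.equivNat.symm T.num = T :=
  Ty.equivNat.symm_apply_apply T

attribute [fun_prop] computable_tyNum computable_tyOfNum

/-- The constructor of a type: 0 for `⊤`, 1 for variables, 2 for `→`, 3 for `∀^K`, 4 for `∀^⊤`. -/
def Ty.tag (T : Ty) : ℕ := cond (eqB T.num 0) 0 ((T.num - 1) % 4 + 1)

/-- The index of a type variable. -/
def Ty.idx (T : Ty) : ℕ := (T.num - 1) / 4

/-- The left component of a compound type. -/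
noncomputable def Ty.left (T : Ty) : Ty := Ty.equivNat.symm ((T.num - 1) / 4).unpair.1

/-- The right component of a compound type. -/
noncomputable def Ty.right (T : Ty) : Ty := Ty.equivNat.symm ((T.num - 1) / 4).unpair.2

/-- The compound type with a given tag and given components. -/
noncomputable def Ty.mk (k : ℕ) (S T : Ty) : Ty := Ty.equivNat.symm (4 * Nat.pair S.num T.num + k)

@[fun_prop] theorem computable_tag : Computable Ty.tag := by unfold Ty.tag; fun_prop
@[fun_prop] theorem computable_idx : Computable Ty.idx := by unfold Ty.idx; fun_prop
@[fun_prop] theorem computable_left : Computable Ty.left := by unfold Ty.left; fun_prop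
@[fun_prop] theorem computable_right : Computable Ty.right := by unfold Ty.right; fun_prop

section
variable {α : Type*} [Primcodable α]

@[fun_prop] theorem computable_mk {k : α → ℕ} {S T : α → Ty} (hk : Computable k)
    (hS : Computable S) (hT : Computable T) : Computable fun a => Ty.mk (k a) (S a) (T a) := by
  unfold Ty.mk; fun_prop

@[fun_prop] theorem computable_var {i : α → ℕ} (hi : Computable i) :
    Computable fun a => Ty.var (i a) :=
  (show Computable fun a => Ty.equivNat.symm (4 * i a + 1) by fun_prop).of_eq
    fun a => Ty.equivNat_symm_num (.var (i a))

@[simp] theorem mk_two (S T : Ty) : Ty.mk 2 S T = .arrow S T := Ty.equivNat_symm_num (.arrow S T)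
@[simp] theorem mk_three (S T : Ty) : Ty.mk 3 S T = .all .K S T :=
  Ty.equivNat_symm_num (.all .K S T)
@[simp] theorem mk_four (S T : Ty) : Ty.mk 4 S T = .all .top S T :=
  Ty.equivNat_symm_num (.all .top S T)

end

@[simp] theorem tag_top : Ty.top.tag = 0 := rfl

@[simp] theorem tag_var (i : ℕ) : (Ty.var i).tag = 1 := by
  simp [Ty.tag, Ty.num, eqB]

@[simp] theorem tag_arrow (S T : Ty) : (Ty.arrow S T).tag = 2 := by
  simp only [Ty.tag, Ty.num, eqB]; simp

@[simp] theorem tag_allK (S T : Ty) : (Ty.all .K S T).tag = 3 := by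
  simp only [Ty.tag, Ty.num, eqB]; simp

@[simp] theorem tag_allTop (S T : Ty) : (Ty.all .top S T).tag = 4 := by
  simp only [Ty.tag, Ty.num, eqB]; simp

@[simp] theorem idx_var (i : ℕ) : (Ty.var i).idx = i := by
  simp [Ty.idx, Ty.num]

theorem left_of_num {T : Ty} {r : ℕ} {A B : Ty} (h : T.num = 4 * Nat.pair A.num B.num + r)
    (hr : 1 ≤ r) (hr' : r ≤ 4) : T.left = A ∧ T.right = B := by
  have e : (T.num - 1) / 4 = Nat.pair A.num B.num := by omega
  simp [Ty.left, Ty.right, e]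

@[simp] theorem left_arrow (S T : Ty) : (Ty.arrow S T).left = S :=
  (left_of_num (r := 2) rfl (by simp) (by simp)).1
@[simp] theorem right_arrow (S T : Ty) : (Ty.arrow S T).right = T :=
  (left_of_num (r := 2) rfl (by simp) (by simp)).2
@[simp] theorem left_all (q : Quant) (S T : Ty) : (Ty.all q S T).left = S := by
  cases q
  · exact (left_of_num (r := 3) rfl (by simp) (by simp)).1
  · exact (left_of_num (r := 4) rfl (by simp) (by simp)).1
@[simp] theorem right_all (q : Quant) (S T : Ty) : (Ty.all q S T).right = T := by
  cases q
  · exact (left_of_num (r := 3) rfl (by simp) (by simp)).2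
  · exact (left_of_num (r := 4) rfl (by simp) (by simp)).2

/-- A context entry is a type together with the information whether it is a bound. -/
def Entry.equivProd : Entry ≃ Bool × Ty where
  toFun
    | .ty S => (true, S)
    | .tm S => (false, S)
  invFun
    | (true, S) => .ty S
    | (false, S) => .tm S
  left_inv := by rintro (_ | _) <;> rfl
  right_inv := by rintro ⟨_ | _, _⟩ <;> rfl

noncomputable instance : Primcodable Entry := Primcodable.ofEquiv (Bool × Ty) Entry.equivProd

@[fun_prop] theorem computable_entry : Computable Entry.equivProd :=
  (Primrec.of_equiv (e := Entry.equivProd)).to_comp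

@[fun_prop] theorem computable_entry_symm : Computable Entry.equivProd.symm :=
  (Primrec.of_equiv_symm (e := Entry.equivProd)).to_comp

section
variable {α : Type*} [Primcodable α]

@[fun_prop] theorem computable_entryTy {S : α → Ty} (hS : Computable S) :
    Computable fun a => Entry.ty (S a) :=
  (show Computable fun a => Entry.equivProd.symm (true, S a) by fun_prop)

@[fun_prop] theorem computable_entryTm {S : α → Ty} (hS : Computable S) :
    Computable fun a => Entry.tm (S a) :=
  (show Computable fun a => Entry.equivProd.symm (false, S a) by fun_prop)

end

/-- The form of a context: 0 for the empty context, and 1 or 2 if the last entry is a bound or the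
type of a term variable. -/
def Ctx.kind (Θ : Ctx) : ℕ :=
  cond Θ.head?.isSome (cond (Entry.equivProd (Θ.head?.getD (.tm .top))).1 1 2) 0

/-- The type in the last entry of a context. -/
def Ctx.head (Θ : Ctx) : Ty := (Entry.equivProd (Θ.head?.getD (.tm .top))).2

@[fun_prop] theorem computable_kind : Computable Ctx.kind := by unfold Ctx.kind; fun_prop
@[fun_prop] theorem computable_head : Computable Ctx.head := by unfold Ctx.head; fun_prop

@[simp] theorem kind_nil : Ctx.kind [] = 0 := rfl
@[simp] theorem kind_ty (S : Ty) (Θ : Ctx) : Ctx.kind (.ty S :: Θ) = 1 := rfl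
@[simp] theorem kind_tm (S : Ty) (Θ : Ctx) : Ctx.kind (.tm S :: Θ) = 2 := rfl
@[simp] theorem head_ty (S : Ty) (Θ : Ctx) : Ctx.head (.ty S :: Θ) = S := rfl
@[simp] theorem head_tm (S : Ty) (Θ : Ctx) : Ctx.head (.tm S :: Θ) = S := rfl

/-- A bijective numbering of terms. -/
def Tm.num : Tm → ℕ
  | .top => 0
  | .var i => 5 * i + 1
  | .lam S t => 5 * Nat.pair S.num t.num + 2
  | .tlam S t => 5 * Nat.pair S.num t.num + 3
  | .app t s => 5 * Nat.pair t.num s.num + 4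
  | .tapp t S => 5 * Nat.pair t.num S.num + 5

theorem Tm.num_injective : Function.Injective Tm.num := by
  intro s
  induction s with
  | top => rintro (_ | _ | _ | _ | _ | _) h <;> simp only [Tm.num] at h <;> first | rfl | omega
  | var i =>
    rintro (_ | _ | _ | _ | _ | _) h <;> simp only [Tm.num] at h <;>
      first | omega | (congr 1; omega)
  | lam S t ih =>
    rintro (_ | _ | ⟨S', t'⟩ | _ | _ | _) h <;> simp only [Tm.num] at h <;> try omega
    have h := Nat.pair_eq_pair.1 (show Nat.pair S.num t.num = Nat.pair S'.num t'.num by omega)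
    rw [Ty.num_injective h.1, ih h.2]
  | tlam S t ih =>
    rintro (_ | _ | _ | ⟨S', t'⟩ | _ | _) h <;> simp only [Tm.num] at h <;> try omega
    have h := Nat.pair_eq_pair.1 (show Nat.pair S.num t.num = Nat.pair S'.num t'.num by omega)
    rw [Ty.num_injective h.1, ih h.2]
  | app t s iht ihs =>
    rintro (_ | _ | _ | _ | ⟨t', s'⟩ | _) h <;> simp only [Tm.num] at h <;> try omega
    have h := Nat.pair_eq_pair.1 (show Nat.pair t.num s.num = Nat.pair t'.num s'.num by omega)
    rw [iht h.1, ihs h.2]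
  | tapp t S ih =>
    rintro (_ | _ | _ | _ | _ | ⟨t', S'⟩) h <;> simp only [Tm.num] at h <;> try omega
    have h := Nat.pair_eq_pair.1 (show Nat.pair t.num S.num = Nat.pair t'.num S'.num by omega)
    rw [ih h.1, Ty.num_injective h.2]

theorem Tm.num_surjective : Function.Surjective Tm.num := by
  intro n
  induction n using Nat.strong_induction_on with
  | _ n ih =>
    rcases n with _ | n
    · exact ⟨.top, rfl⟩
    obtain ⟨s, hs⟩ := ih (n / 5).unpair.1 (by have := Nat.unpair_left_le (n / 5); omega)
    obtain ⟨t, ht⟩ := ih (n / 5).unpair.2 (by have := Nat.unpair_right_le (n / 5); omega)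
    obtain ⟨S, hS⟩ := Ty.num_surjective (n / 5).unpair.1
    obtain ⟨T, hT⟩ := Ty.num_surjective (n / 5).unpair.2
    have h1 : Nat.pair s.num t.num = n / 5 := by rw [hs, ht, Nat.pair_unpair]
    have h2 : Nat.pair S.num t.num = n / 5 := by rw [hS, ht, Nat.pair_unpair]
    have h3 : Nat.pair s.num T.num = n / 5 := by rw [hs, hT, Nat.pair_unpair]
    have h5 : n % 5 = 0 ∨ n % 5 = 1 ∨ n % 5 = 2 ∨ n % 5 = 3 ∨ n % 5 = 4 := by omega
    rcases h5 with h | h | h | h | h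
    · exact ⟨.var (n / 5), by simp only [Tm.num]; omega⟩
    · exact ⟨.lam S t, by simp only [Tm.num, h2]; omega⟩
    · exact ⟨.tlam S t, by simp only [Tm.num, h2]; omega⟩
    · exact ⟨.app s t, by simp only [Tm.num, h1]; omega⟩
    · exact ⟨.tapp s T, by simp only [Tm.num, h3]; omega⟩

/-- Terms correspond to natural numbers. -/
noncomputable def Tm.equivNat : Tm ≃ ℕ := Equiv.ofBijective Tm.num ⟨Tm.num_injective, Tm.num_surjective⟩

noncomputable instance : Primcodable Tm := Primcodable.ofEquiv ℕ Tm.equivNat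

theorem computable_tmNum : Computable Tm.num := (Primrec.of_equiv (e := Tm.equivNat)).to_comp

theorem computable_tmOfNum : Computable Tm.equivNat.symm :=
  (Primrec.of_equiv_symm (e := Tm.equivNat)).to_comp

@[simp] theorem Tm.equivNat_symm_num (t : Tm) : Tm.equivNat.symm t.num = t :=
  Tm.equivNat.symm_apply_apply t

attribute [fun_prop] computable_tmNum computable_tmOfNum

/-- The constructor of a term, as a number from 0 to 5. -/
def Tm.tag (t : Tm) : ℕ := cond (eqB t.num 0) 0 ((t.num - 1) % 5 + 1)

/-- The number of the arguments of the constructor of a term. -/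
def Tm.arg (t : Tm) : ℕ := (t.num - 1) / 5

/-- The first argument of the constructor, read as a type. -/
noncomputable def Tm.tyL (t : Tm) : Ty := Ty.equivNat.symm t.arg.unpair.1

/-- The second argument of the constructor, read as a type. -/
noncomputable def Tm.tyR (t : Tm) : Ty := Ty.equivNat.symm t.arg.unpair.2

/-- The first argument of the constructor, read as a term. -/
noncomputable def Tm.tmL (t : Tm) : Tm := Tm.equivNat.symm t.arg.unpair.1

/-- The second argument of the constructor, read as a term. -/
noncomputable def Tm.tmR (t : Tm) : Tm := Tm.equivNat.symm t.arg.unpair.2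

@[fun_prop] theorem computable_tmTag : Computable Tm.tag := by unfold Tm.tag; fun_prop
@[fun_prop] theorem computable_arg : Computable Tm.arg := by unfold Tm.arg; fun_prop
@[fun_prop] theorem computable_tyL : Computable Tm.tyL := by unfold Tm.tyL; fun_prop
@[fun_prop] theorem computable_tyR : Computable Tm.tyR := by unfold Tm.tyR; fun_prop
@[fun_prop] theorem computable_tmL : Computable Tm.tmL := by unfold Tm.tmL; fun_prop
@[fun_prop] theorem computable_tmR : Computable Tm.tmR := by unfold Tm.tmR; fun_prop

theorem tmTag_of_num {t : Tm} {m r : ℕ} (h : t.num = 5 * m + (r + 1)) (hr : r < 5) :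
    t.tag = r + 1 := by
  have : t.num ≠ 0 := by omega
  simp only [Tm.tag, eqB, this, decide_false, cond_false]
  omega

theorem arg_of_num {t : Tm} {m r : ℕ} (h : t.num = 5 * m + (r + 1)) (hr : r < 5) :
    t.arg = m := by
  simp only [Tm.arg]
  omega

@[simp] theorem tmTag_top : Tm.top.tag = 0 := rfl
@[simp] theorem tmTag_var (i : ℕ) : (Tm.var i).tag = 1 := tmTag_of_num (r := 0) rfl (by simp)
@[simp] theorem tmTag_lam (S : Ty) (t : Tm) : (Tm.lam S t).tag = 2 :=
  tmTag_of_num (r := 1) rfl (by simp)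
@[simp] theorem tmTag_tlam (S : Ty) (t : Tm) : (Tm.tlam S t).tag = 3 :=
  tmTag_of_num (r := 2) rfl (by simp)
@[simp] theorem tmTag_app (t s : Tm) : (Tm.app t s).tag = 4 := tmTag_of_num (r := 3) rfl (by simp)
@[simp] theorem tmTag_tapp (t : Tm) (S : Ty) : (Tm.tapp t S).tag = 5 :=
  tmTag_of_num (r := 4) rfl (by simp)
@[simp] theorem arg_var (i : ℕ) : (Tm.var i).arg = i := arg_of_num (r := 0) rfl (by simp)
theorem arg_lam (S : Ty) (t : Tm) : (Tm.lam S t).arg = Nat.pair S.num t.num :=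
  arg_of_num (r := 1) rfl (by simp)
theorem arg_tlam (S : Ty) (t : Tm) : (Tm.tlam S t).arg = Nat.pair S.num t.num :=
  arg_of_num (r := 2) rfl (by simp)
theorem arg_app (t s : Tm) : (Tm.app t s).arg = Nat.pair t.num s.num :=
  arg_of_num (r := 3) rfl (by simp)
theorem arg_tapp (t : Tm) (S : Ty) : (Tm.tapp t S).arg = Nat.pair t.num S.num :=
  arg_of_num (r := 4) rfl (by simp)
@[simp] theorem tyL_lam (S : Ty) (t : Tm) : (Tm.lam S t).tyL = S := by simp [Tm.tyL, arg_lam]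
@[simp] theorem tmR_lam (S : Ty) (t : Tm) : (Tm.lam S t).tmR = t := by simp [Tm.tmR, arg_lam]
@[simp] theorem tyL_tlam (S : Ty) (t : Tm) : (Tm.tlam S t).tyL = S := by simp [Tm.tyL, arg_tlam]
@[simp] theorem tmR_tlam (S : Ty) (t : Tm) : (Tm.tlam S t).tmR = t := by simp [Tm.tmR, arg_tlam]
@[simp] theorem tmL_app (t s : Tm) : (Tm.app t s).tmL = t := by simp [Tm.tmL, arg_app]
@[simp] theorem tmR_app (t s : Tm) : (Tm.app t s).tmR = s := by simp [Tm.tmR, arg_app]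
@[simp] theorem tmL_tapp (t : Tm) (S : Ty) : (Tm.tapp t S).tmL = t := by simp [Tm.tmL, arg_tapp]
@[simp] theorem tyR_tapp (t : Tm) (S : Ty) : (Tm.tapp t S).tyR = S := by simp [Tm.tyR, arg_tapp]

section
variable {α : Type*} [Primcodable α]

@[fun_prop] theorem computable_tmVar {i : α → ℕ} (hi : Computable i) :
    Computable fun a => Tm.var (i a) :=
  (show Computable fun a => Tm.equivNat.symm (5 * i a + 1) by fun_prop).of_eq
    fun a => Tm.equivNat_symm_num (.var (i a))

@[fun_prop] theorem computable_lam {S : α → Ty} {t : α → Tm} (hS : Computable S)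
    (ht : Computable t) : Computable fun a => Tm.lam (S a) (t a) :=
  (show Computable fun a => Tm.equivNat.symm (5 * Nat.pair (S a).num (t a).num + 2) by
    fun_prop).of_eq fun a => Tm.equivNat_symm_num (.lam (S a) (t a))

@[fun_prop] theorem computable_tlam {S : α → Ty} {t : α → Tm} (hS : Computable S)
    (ht : Computable t) : Computable fun a => Tm.tlam (S a) (t a) :=
  (show Computable fun a => Tm.equivNat.symm (5 * Nat.pair (S a).num (t a).num + 3) by
    fun_prop).of_eq fun a => Tm.equivNat_symm_num (.tlam (S a) (t a))

@[fun_prop] theorem computable_app {t s : α → Tm} (ht : Computable t) (hs : Computable s) :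
    Computable fun a => Tm.app (t a) (s a) :=
  (show Computable fun a => Tm.equivNat.symm (5 * Nat.pair (t a).num (s a).num + 4) by
    fun_prop).of_eq fun a => Tm.equivNat_symm_num (.app (t a) (s a))

@[fun_prop] theorem computable_tapp {t : α → Tm} {S : α → Ty} (ht : Computable t)
    (hS : Computable S) : Computable fun a => Tm.tapp (t a) (S a) :=
  (show Computable fun a => Tm.equivNat.symm (5 * Nat.pair (t a).num (S a).num + 5) by
    fun_prop).of_eq fun a => Tm.equivNat_symm_num (.tapp (t a) (S a))

end


/-! ### Computability of the operations on types and contexts -/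

-- The pattern for the recursions on types below: tags under 2 are the leaves, both components are
-- visited, and the index moves up only under a quantifier, not on the right of an arrow (tag 2).
@[fun_prop]
theorem computable_shift' : Computable fun x : ℕ × Ty => x.2.shift x.1 := by
  refine computable_of_binary_rec (fun x => sizeOf x.2) (isLeaf := fun x => ltB x.2.tag 2)
    (l := fun x => (x.1, x.2.left))
    (r := fun x => (cond (eqB x.2.tag 2) x.1 (x.1 + 1), x.2.right))
    (base := fun x => cond (eqB x.2.tag 0) .top
      (.var (cond (ltB x.2.idx x.1) x.2.idx (x.2.idx + 1))))
    (step := fun x A B => Ty.mk x.2.tag A B)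
    (by fun_prop) (by fun_prop) (by fun_prop) (by fun_prop) (by fun_prop) ?_ ?_
  · rintro ⟨c, _ | i | _ | ⟨_ | _, _, _⟩⟩ h <;> simp [ltB, eqB, Ty.shift, Bool.cond_decide] at h ⊢
  · rintro ⟨c, _ | i | _ | ⟨_ | _, _, _⟩⟩ h <;> simp [ltB, eqB, Ty.shift] at h ⊢ <;> omega

section
variable {α : Type*} [Primcodable α]

@[fun_prop]
theorem computable_shift {c : α → ℕ} {T : α → Ty} (hc : Computable c) (hT : Computable T) :
    Computable fun a => (T a).shift (c a) := computable_shift'.comp (hc.pair hT)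

theorem computable_subst' : Computable fun x : ℕ × Ty × Ty => Ty.subst x.1 x.2.1 x.2.2 := by
  refine computable_of_binary_rec (fun x => sizeOf x.2.2) (isLeaf := fun x => ltB x.2.2.tag 2)
    (l := fun x => (x.1, x.2.1, x.2.2.left))
    (r := fun x => cond (eqB x.2.2.tag 2) (x.1, x.2.1, x.2.2.right)
      (x.1 + 1, x.2.1.shift 0, x.2.2.right))
    (base := fun x => cond (eqB x.2.2.tag 0) .top
      (cond (ltB x.2.2.idx x.1) (.var x.2.2.idx) (cond (eqB x.2.2.idx x.1) x.2.1
        (.var (x.2.2.idx - 1)))))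
    (step := fun x A B => Ty.mk x.2.2.tag A B)
    (by fun_prop) (by fun_prop) (by fun_prop) (by fun_prop) (by fun_prop) ?_ ?_
  · rintro ⟨c, U, _ | i | _ | ⟨_ | _, _, _⟩⟩ h <;>
      simp [ltB, eqB, Ty.subst, Bool.cond_decide] at h ⊢
  · rintro ⟨c, U, _ | i | _ | ⟨_ | _, _, _⟩⟩ h <;> simp [ltB, eqB, Ty.subst] at h ⊢ <;> omega

@[fun_prop]
theorem computable_subst {c : α → ℕ} {U T : α → Ty} (hc : Computable c) (hU : Computable U)
    (hT : Computable T) : Computable fun a => Ty.subst (c a) (U a) (T a) :=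
  computable_subst'.comp (hc.pair (hU.pair hT))

theorem computable_scoped' : Computable fun x : ℕ × Ty => x.2.scoped x.1 := by
  refine computable_of_binary_rec (fun x => sizeOf x.2) (isLeaf := fun x => ltB x.2.tag 2)
    (l := fun x => (x.1, x.2.left))
    (r := fun x => (cond (eqB x.2.tag 2) x.1 (x.1 + 1), x.2.right))
    (base := fun x => cond (eqB x.2.tag 0) true (ltB x.2.idx x.1))
    (step := fun x a b => a && b)
    (by fun_prop) (by fun_prop) (by fun_prop) (by fun_prop) (by fun_prop) ?_ ?_
  · rintro ⟨c, _ | i | _ | ⟨_ | _, _, _⟩⟩ h <;> simp [ltB, eqB, Ty.scoped] at h ⊢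
  · rintro ⟨c, _ | i | _ | ⟨_ | _, _, _⟩⟩ h <;> simp [ltB, eqB, Ty.scoped] at h ⊢ <;> omega

@[fun_prop]
theorem computable_scoped {n : α → ℕ} {T : α → Ty} (hn : Computable n) (hT : Computable T) :
    Computable fun a => (T a).scoped (n a) := computable_scoped'.comp (hn.pair hT)

end

/-- Test that all quantifiers are `∀^⊤`. -/
def Ty.ftopB : Ty → Bool
  | .top => true
  | .var _ => true
  | .arrow S T => S.ftopB && T.ftopB
  | .all .K _ _ => false
  | .all .top S T => S.ftopB && T.ftopB

theorem Ty.ftopB_iff {T : Ty} : T.ftopB = true ↔ T.IsFTop := by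
  induction T with
  | top => simp [Ty.ftopB, Ty.IsFTop]
  | var i => simp [Ty.ftopB, Ty.IsFTop]
  | arrow S T ihS ihT => simp [Ty.ftopB, Ty.IsFTop, ihS, ihT]
  | all q S T ihS ihT => cases q <;> simp [Ty.ftopB, Ty.IsFTop, ihS, ihT]

@[fun_prop]
theorem computable_ftopB : Computable Ty.ftopB := by
  refine computable_of_binary_rec (fun x => sizeOf x) (isLeaf := fun x => ltB x.tag 2)
    (l := Ty.left) (r := Ty.right) (base := fun _ => true)
    (step := fun x a b => cond (eqB x.tag 3) false (a && b))
    (by fun_prop) (by fun_prop) (by fun_prop) (by fun_prop) (by fun_prop) ?_ ?_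
  · rintro (_ | i | _ | ⟨_ | _, _, _⟩) h <;> simp [ltB, Ty.ftopB] at h ⊢
  · rintro (_ | i | _ | ⟨_ | _, _, _⟩) h <;> simp [ltB, eqB, Ty.ftopB] at h ⊢ <;> omega

/-- Test that all quantifiers in a term are `∀^⊤`. -/
def Tm.ftopB : Tm → Bool
  | .top => true
  | .var _ => true
  | .lam S t => S.ftopB && t.ftopB
  | .tlam S t => S.ftopB && t.ftopB
  | .app t s => t.ftopB && s.ftopB
  | .tapp t S => t.ftopB && S.ftopB

theorem Tm.ftopB_iff {t : Tm} : t.ftopB = true ↔ t.IsFTop := by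
  induction t <;> simp_all [Tm.ftopB, Tm.IsFTop, Ty.ftopB_iff]

@[fun_prop]
theorem computable_tmFtopB : Computable Tm.ftopB := by
  refine computable_of_binary_rec (fun x => sizeOf x) (isLeaf := fun x => ltB x.tag 2)
    -- A constructor with a single subterm sends both recursive calls to that subterm, so that the
    -- measure drops in each.
    (l := fun x => cond (ltB x.tag 4) x.tmR x.tmL)
    (r := fun x => cond (eqB x.tag 5) x.tmL x.tmR) (base := fun _ => true)
    (step := fun x a b => cond (ltB x.tag 4) (x.tyL.ftopB && b)
      (cond (eqB x.tag 4) (a && b) (a && x.tyR.ftopB)))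
    (by fun_prop) (by fun_prop) (by fun_prop) (by fun_prop) (by fun_prop) ?_ ?_
  · rintro (_ | i | _ | _ | _ | _) h <;> simp [ltB, Tm.ftopB] at h ⊢
  · rintro (_ | i | _ | _ | _ | _) h <;> simp [ltB, eqB, Tm.ftopB] at h ⊢ <;> omega

-- A recursion on contexts is unary; it is made binary by calling the tail twice and ignoring the
-- second result.
@[fun_prop]
theorem computable_numTy : Computable Ctx.numTy := by
  refine computable_of_binary_rec List.length (isLeaf := fun Θ => eqB (Ctx.kind Θ) 0)
    (l := List.tail) (r := List.tail) (base := fun _ => 0)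
    (step := fun Θ a _ => cond (eqB (Ctx.kind Θ) 1) (a + 1) a)
    (by fun_prop) (by fun_prop) (by fun_prop) (by fun_prop) (by fun_prop) ?_ ?_
  · rintro (_ | ⟨_ | _, _⟩) h <;> simp [eqB, Ctx.numTy] at h ⊢
  · rintro (_ | ⟨_ | _, _⟩) h <;> simp [eqB, Ctx.numTy] at h ⊢

@[fun_prop]
theorem computable_check : Computable Ctx.check := by
  refine computable_of_binary_rec List.length (isLeaf := fun Θ => eqB (Ctx.kind Θ) 0)
    (l := List.tail) (r := List.tail) (base := fun _ => true)
    (step := fun Θ a _ => a && (Ctx.head Θ).scoped (Ctx.numTy Θ.tail))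
    (by fun_prop) (by fun_prop) (by fun_prop) (by fun_prop) (by fun_prop) ?_ ?_
  · rintro (_ | ⟨_ | _, _⟩) h <;> simp [eqB, Ctx.check] at h ⊢
  · rintro (_ | ⟨_ | _, _⟩) h <;> simp [eqB, Ctx.check] at h ⊢

/-- Test that all quantifiers in a context are `∀^⊤`. -/
def Ctx.ftopB : Ctx → Bool
  | [] => true
  | .ty S :: Θ => S.ftopB && Ctx.ftopB Θ
  | .tm S :: Θ => S.ftopB && Ctx.ftopB Θ

theorem Ctx.ftopB_iff : ∀ {Θ : Ctx}, Ctx.ftopB Θ = true ↔ Ctx.IsFTop Θ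
  | [] => by simp [Ctx.ftopB, Ctx.IsFTop]
  | .ty _ :: Θ => by simp [Ctx.ftopB, Ctx.IsFTop, Ty.ftopB_iff, Ctx.ftopB_iff (Θ := Θ)]
  | .tm _ :: Θ => by simp [Ctx.ftopB, Ctx.IsFTop, Ty.ftopB_iff, Ctx.ftopB_iff (Θ := Θ)]

@[fun_prop]
theorem computable_ctxFtopB : Computable Ctx.ftopB := by
  refine computable_of_binary_rec List.length (isLeaf := fun Θ => eqB (Ctx.kind Θ) 0)
    (l := List.tail) (r := List.tail) (base := fun _ => true)
    (step := fun Θ a _ => (Ctx.head Θ).ftopB && a)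
    (by fun_prop) (by fun_prop) (by fun_prop) (by fun_prop) (by fun_prop) ?_ ?_
  · rintro (_ | ⟨_ | _, _⟩) h <;> simp [eqB, Ctx.ftopB] at h ⊢
  · rintro (_ | ⟨_ | _, _⟩) h <;> simp [eqB, Ctx.ftopB] at h ⊢

/-- Shift the type in an option. -/
def shiftOption (o : Option Ty) : Option Ty := cond o.isSome (some ((o.getD .top).shift 0)) none

theorem shiftOption_eq (o : Option Ty) : shiftOption o = o.map (Ty.shift 0) := by
  cases o <;> rfl

@[fun_prop] theorem computable_shiftOption : Computable shiftOption := by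
  unfold shiftOption; fun_prop

theorem computable_bound' : Computable fun x : Ctx × ℕ => Ctx.bound x.1 x.2 := by
  refine computable_of_binary_rec (fun x => x.1.length)
    (isLeaf := fun x => eqB x.1.kind 0 || (eqB x.1.kind 1 && eqB x.2 0))
    (l := fun x => (x.1.tail, cond (eqB x.1.kind 1) (x.2 - 1) x.2))
    (r := fun x => (x.1.tail, cond (eqB x.1.kind 1) (x.2 - 1) x.2))
    (base := fun x => cond (eqB x.1.kind 0) none (some ((Ctx.head x.1).shift 0)))
    (step := fun x a _ => cond (eqB x.1.kind 1) (shiftOption a) a)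
    (by fun_prop) (by fun_prop) (by fun_prop) (by fun_prop) (by fun_prop) ?_ ?_
  · rintro ⟨_ | ⟨_ | _, _⟩, _ | i⟩ h <;> simp [eqB, Ctx.bound] at h ⊢
  · rintro ⟨_ | ⟨_ | _, _⟩, _ | i⟩ h <;> simp [eqB, Ctx.bound, shiftOption_eq] at h ⊢

theorem computable_type' : Computable fun x : Ctx × ℕ => Ctx.type x.1 x.2 := by
  refine computable_of_binary_rec (fun x => x.1.length)
    (isLeaf := fun x => eqB x.1.kind 0 || (eqB x.1.kind 2 && eqB x.2 0))
    (l := fun x => (x.1.tail, cond (eqB x.1.kind 2) (x.2 - 1) x.2))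
    (r := fun x => (x.1.tail, cond (eqB x.1.kind 2) (x.2 - 1) x.2))
    (base := fun x => cond (eqB x.1.kind 0) none (some (Ctx.head x.1)))
    (step := fun x a _ => cond (eqB x.1.kind 1) (shiftOption a) a)
    (by fun_prop) (by fun_prop) (by fun_prop) (by fun_prop) (by fun_prop) ?_ ?_
  · rintro ⟨_ | ⟨_ | _, _⟩, _ | i⟩ h <;> simp [eqB, Ctx.type] at h ⊢
  · rintro ⟨_ | ⟨_ | _, _⟩, _ | i⟩ h <;> simp [eqB, Ctx.type, shiftOption_eq] at h ⊢

theorem computable_expose' : Computable fun x : Ctx × Ty => Ctx.expose x.1 x.2 := by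
  refine computable_of_binary_rec (fun x => x.1.length)
    -- Recursion happens only for a variable over a nonempty context; every other pair returns its
    -- type unchanged.
    (isLeaf := fun x => !(!eqB x.1.kind 0 && eqB x.2.tag 1))
    (l := fun x => (x.1.tail, cond (eqB x.1.kind 2) x.2
      (cond (eqB x.2.idx 0) x.1.head (.var (x.2.idx - 1)))))
    (r := fun x => (x.1.tail, x.2))
    (base := fun x => x.2)
    (step := fun x A _ => cond (eqB x.1.kind 2) A (A.shift 0))
    (by fun_prop) (by fun_prop) (by fun_prop) (by fun_prop) (by fun_prop) ?_ ?_
  · rintro ⟨_ | ⟨_ | _, _⟩, _ | (_ | i) | _ | ⟨_ | _, _, _⟩⟩ h <;>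
      simp [eqB, Ctx.expose] at h ⊢
  · rintro ⟨_ | ⟨_ | _, _⟩, _ | (_ | i) | _ | ⟨_ | _, _, _⟩⟩ h <;>
      simp [eqB, Ctx.expose] at h ⊢

section
variable {α : Type*} [Primcodable α]

@[fun_prop]
theorem computable_bound {Θ : α → Ctx} {i : α → ℕ} (hΘ : Computable Θ) (hi : Computable i) :
    Computable fun a => Ctx.bound (Θ a) (i a) := computable_bound'.comp (hΘ.pair hi)

@[fun_prop]
theorem computable_type {Θ : α → Ctx} {i : α → ℕ} (hΘ : Computable Θ) (hi : Computable i) :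
    Computable fun a => Ctx.type (Θ a) (i a) := computable_type'.comp (hΘ.pair hi)

@[fun_prop]
theorem computable_expose {Θ : α → Ctx} {T : α → Ty} (hΘ : Computable Θ) (hT : Computable T) :
    Computable fun a => Ctx.expose (Θ a) (T a) := computable_expose'.comp (hΘ.pair hT)

@[fun_prop]
theorem computable_wfCheck {Θ : α → Ctx} {T : α → Ty} (hΘ : Computable Θ) (hT : Computable T) :
    Computable fun a => wfCheck (Θ a) (T a) := by unfold wfCheck; fun_prop

theorem both_eq_cond (x y : Option Bool) :
    both x y = cond (x.isSome && y.isSome) (some (x.getD false && y.getD false)) none := by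
  cases x <;> cases y <;> rfl

@[fun_prop]
theorem computable_both {x y : α → Option Bool} (hx : Computable x) (hy : Computable y) :
    Computable fun a => both (x a) (y a) := by simp only [both_eq_cond]; fun_prop

end

/-! ### Computability of the algorithms -/

/-- The recursion is on the depth, so both calls may be made at every positive depth, even with
meaningless arguments; `step` discards what is not needed. The left call serves promotion of a
variable and the contravariant premise, the right call the covariant one. The tests in `step` follow
the order of the defining clauses. -/
theorem computable_subtype' :
    Computable fun x : ℕ × Ctx × Ty × Ty => subtype x.1 x.2.1 x.2.2.1 x.2.2.2 := by
  refine computable_of_binary_rec (fun x => x.1) (isLeaf := fun x => eqB x.1 0)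
    (l := fun x => (x.1 - 1, x.2.1,
      cond (eqB x.2.2.1.tag 1) ((Ctx.bound x.2.1 x.2.2.1.idx).getD .top) x.2.2.2.left,
      cond (eqB x.2.2.1.tag 1) x.2.2.2 x.2.2.1.left))
    (r := fun x => (x.1 - 1,
      cond (eqB x.2.2.1.tag 2) x.2.1
        -- Two `∀^⊤` bodies are compared under `⊤`; a left `∀^K` contributes its own bound.
        (.ty (cond (eqB x.2.2.1.tag 4) .top x.2.2.1.left) :: x.2.1),
      x.2.2.1.right, x.2.2.2.right))
    (base := fun _ => none)
    (step := fun x a b =>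
      cond (eqB x.2.2.2.tag 0) (some (wfCheck x.2.1 x.2.2.1)) <|
      cond (eqB x.2.2.1.tag 1) (cond (eqB x.2.2.2 x.2.2.1) (some (wfCheck x.2.1 x.2.2.1))
        (cond (Ctx.bound x.2.1 x.2.2.1.idx).isSome a (some false))) <|
      cond (eqB x.2.2.1.tag 2 && eqB x.2.2.2.tag 2) (both a b) <|
      cond (eqB x.2.2.1.tag 3 && eqB x.2.2.2.tag 3)
        (cond (eqB x.2.2.1.left x.2.2.2.left) b (some false)) <|
      cond (ltB 2 x.2.2.1.tag && eqB x.2.2.2.tag 4) (both a b) (some false))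
    (by fun_prop) (by fun_prop) (by fun_prop) (by fun_prop) (by fun_prop) ?_ ?_
  · rintro ⟨n, Θ, S, T⟩ h
    simp only [eqB_iff] at h
    subst h
    rfl
  · rintro ⟨_ | n, Θ, S, T⟩ h
    · simp [eqB] at h
    refine ⟨Nat.lt_succ_self _, Nat.lt_succ_self _, ?_⟩
    by_cases hT : T = .top
    · subst hT
      simp [eqB, subtype_top]
    have hT' : T.tag ≠ 0 := by
      rcases T with _ | _ | _ | ⟨_ | _, _, _⟩ <;> simp at hT ⊢
    rcases S with _ | i | ⟨A, B⟩ | ⟨_ | _, A, B⟩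
    · rcases T with _ | _ | _ | ⟨_ | _, _, _⟩ <;> simp [eqB, ltB, subtype] at hT ⊢
    · rw [subtype_var _ _ _ _ hT]
      cases hb : Ctx.bound Θ i <;> simp [eqB, hT', hb, Bool.cond_decide]
    all_goals
      rcases T with _ | _ | _ | ⟨_ | _, _, _⟩ <;>
        simp [eqB, ltB, subtype, Bool.cond_decide] at hT ⊢

section
variable {α : Type*} [Primcodable α]

@[fun_prop]
theorem computable_subtype {n : α → ℕ} {Θ : α → Ctx} {S T : α → Ty} (hn : Computable n)
    (hΘ : Computable Θ) (hS : Computable S) (hT : Computable T) :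
    Computable fun a => subtype (n a) (Θ a) (S a) (T a) :=
  computable_subtype'.comp (hn.pair (hΘ.pair (hS.pair hT)))

end

/-- The result `some none` of a rejected run, or an unfinished run, if the test failed or is not
complete, and a produced type otherwise. -/
def produce (o : Option Bool) (T : Ty) : Option (Option Ty) :=
  cond o.isSome (some (cond (o.getD false) (some T) none)) none

theorem produce_eq (o : Option Bool) (T : Ty) :
    produce o T = o.map fun b => if b then some T else none := by
  rcases o with _ | _ | _ <;> rfl

/-- The result of the minimal typing algorithm on an abstraction, from that on its body. -/
noncomputable def synthAbs (k : ℕ) (S : Ty) (o : Option (Option Ty)) : Option (Option Ty) :=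
  cond o.isSome (some (cond (o.getD none).isSome
    (some (Ty.mk k S ((o.getD none).getD .top))) none)) none

theorem synthAbs_eq (k : ℕ) (S : Ty) (o : Option (Option Ty)) :
    synthAbs k S o = o.map fun r => r.map fun T => Ty.mk k S T := by
  rcases o with _ | _ | _ <;> rfl

/-- The result of the minimal typing algorithm on an application. -/
noncomputable def synthApp (n : ℕ) (Θ : Ctx) (o o' : Option (Option Ty)) : Option (Option Ty) :=
  cond o.isSome (cond (o.getD none).isSome (cond o'.isSome (cond (o'.getD none).isSome
    (cond (eqB (Ctx.expose Θ ((o.getD none).getD .top)).tag 2)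
      (produce (subtype n Θ ((o'.getD none).getD .top)
        (Ctx.expose Θ ((o.getD none).getD .top)).left)
        (Ctx.expose Θ ((o.getD none).getD .top)).right)
      (some none)) (some none)) none) (some none)) none

/-- The result of the minimal typing algorithm on a type application. -/
noncomputable def synthTapp (n : ℕ) (Θ : Ctx) (o : Option (Option Ty)) (U : Ty) :
    Option (Option Ty) :=
  cond o.isSome (cond (o.getD none).isSome
    (cond (ltB 2 (Ctx.expose Θ ((o.getD none).getD .top)).tag)
      (produce (subtype n Θ U (Ctx.expose Θ ((o.getD none).getD .top)).left)
        (Ty.subst 0 U (Ctx.expose Θ ((o.getD none).getD .top)).right))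
      (some none)) (some none)) none

theorem synth_app (n : ℕ) (Θ : Ctx) (r s : Tm) :
    synth n Θ (.app r s) = synthApp n Θ (synth n Θ r) (synth n Θ s) := by
  simp only [synth]
  rcases synth n Θ r with _ | _ | R
  · rfl
  · rfl
  rcases synth n Θ s with _ | _ | S
  · rfl
  · rfl
  simp only [synthApp, Option.bind_some, Option.isSome_some, Option.getD_some, cond_true]
  rcases Ctx.expose Θ R with _ | _ | _ | ⟨_ | _, _, _⟩ <;> simp [eqB, produce_eq]

theorem synth_tapp (n : ℕ) (Θ : Ctx) (r : Tm) (U : Ty) :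
    synth n Θ (.tapp r U) = synthTapp n Θ (synth n Θ r) U := by
  simp only [synth]
  rcases synth n Θ r with _ | _ | R
  · rfl
  · rfl
  simp only [synthTapp, Option.bind_some, Option.isSome_some, Option.getD_some, cond_true]
  rcases Ctx.expose Θ R with _ | _ | _ | ⟨_ | _, _, _⟩ <;> simp [ltB, produce_eq]

section
variable {α : Type*} [Primcodable α]

@[fun_prop]
theorem computable_produce {o : α → Option Bool} {T : α → Ty} (ho : Computable o)
    (hT : Computable T) : Computable fun a => produce (o a) (T a) := by unfold produce; fun_prop

@[fun_prop]
theorem computable_synthAbs {k : α → ℕ} {S : α → Ty} {o : α → Option (Option Ty)}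
    (hk : Computable k) (hS : Computable S) (ho : Computable o) :
    Computable fun a => synthAbs (k a) (S a) (o a) := by unfold synthAbs; fun_prop

@[fun_prop]
theorem computable_synthApp {n : α → ℕ} {Θ : α → Ctx} {o o' : α → Option (Option Ty)}
    (hn : Computable n) (hΘ : Computable Θ) (ho : Computable o) (ho' : Computable o') :
    Computable fun a => synthApp (n a) (Θ a) (o a) (o' a) := by unfold synthApp; fun_prop

@[fun_prop]
theorem computable_synthTapp {n : α → ℕ} {Θ : α → Ctx} {o : α → Option (Option Ty)} {U : α → Ty}
    (hn : Computable n) (hΘ : Computable Θ) (ho : Computable o) (hU : Computable U) :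
    Computable fun a => synthTapp (n a) (Θ a) (o a) (U a) := by unfold synthTapp; fun_prop

end

/-- The recursion is on the term, with the depth as a parameter. The body of an abstraction is
visited even when its annotation is ill-formed; that result is then discarded. -/
theorem computable_synth' : Computable fun x : ℕ × Ctx × Tm => synth x.1 x.2.1 x.2.2 := by
  refine computable_of_binary_rec (fun x => sizeOf x.2.2) (isLeaf := fun x => ltB x.2.2.tag 2)
    (l := fun x => (x.1,
      cond (eqB x.2.2.tag 2) (.tm x.2.2.tyL :: x.2.1)
        (cond (eqB x.2.2.tag 3) (.ty x.2.2.tyL :: x.2.1) x.2.1),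
      cond (ltB x.2.2.tag 4) x.2.2.tmR x.2.2.tmL))
    (r := fun x => (x.1, x.2.1, cond (eqB x.2.2.tag 5) x.2.2.tmL x.2.2.tmR))
    (base := fun x => cond (eqB x.2.2.tag 0) (some (some .top))
      (some (Ctx.type x.2.1 x.2.2.arg)))
    (step := fun x a b =>
      cond (ltB x.2.2.tag 4)
        (cond (wfCheck x.2.1 x.2.2.tyL) (synthAbs x.2.2.tag x.2.2.tyL a) (some none))
        (cond (eqB x.2.2.tag 4) (synthApp x.1 x.2.1 a b) (synthTapp x.1 x.2.1 a x.2.2.tyR)))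
    (by fun_prop) (by fun_prop) (by fun_prop) (by fun_prop) (by fun_prop) ?_ ?_
  · rintro ⟨n, Θ, _ | i | _ | _ | _ | _⟩ h <;> simp [ltB, eqB, synth] at h ⊢
  · rintro ⟨n, Θ, _ | i | _ | ⟨S, t⟩ | _ | _⟩ h
    · simp [ltB] at h
    · simp [ltB] at h
    · refine ⟨by simp [ltB], by simp [eqB], ?_⟩
      simp [ltB, eqB, synthAbs_eq, synth, cond_eq_ite]
    · refine ⟨by simp [ltB], by simp [eqB], ?_⟩
      simp [ltB, eqB, synthAbs_eq, synth, cond_eq_ite]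
    · refine ⟨by simp [ltB]; omega, by simp [eqB], ?_⟩
      simp [ltB, eqB, synth_app]
    · refine ⟨by simp [ltB]; omega, by simp [eqB]; omega, ?_⟩
      simp [ltB, eqB, synth_tapp]

theorem typecheck_eq (n : ℕ) (Θ : Ctx) (t : Tm) (T : Ty) :
    typecheck n Θ t T = cond (synth n Θ t).isSome (cond ((synth n Θ t).getD none).isSome
      (subtype n Θ (((synth n Θ t).getD none).getD .top) T) (some false)) none := by
  rw [typecheck]
  rcases synth n Θ t with _ | _ | _ <;> rfl

section
variable {α : Type*} [Primcodable α]

@[fun_prop]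
theorem computable_synth {n : α → ℕ} {Θ : α → Ctx} {t : α → Tm} (hn : Computable n)
    (hΘ : Computable Θ) (ht : Computable t) : Computable fun a => synth (n a) (Θ a) (t a) :=
  computable_synth'.comp (hn.pair (hΘ.pair ht))

@[fun_prop]
theorem computable_typecheck {n : α → ℕ} {Θ : α → Ctx} {t : α → Tm} {T : α → Ty}
    (hn : Computable n) (hΘ : Computable Θ) (ht : Computable t) (hT : Computable T) :
    Computable fun a => typecheck (n a) (Θ a) (t a) (T a) := by
  simp only [typecheck_eq]; fun_prop

end


/-! ### Decoding Gödel numbers -/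

theorem tyCode_inj {S T : Ty} : S.code = T.code ↔ S = T := ⟨Ty.code_injective S T, congrArg _⟩

theorem tmCode_inj {s t : Tm} : s.code = t.code ↔ s = t := ⟨Tm.code_injective s t, congrArg _⟩

theorem ctxCode_inj {Θ Δ : Ctx} : Ctx.code Θ = Ctx.code Δ ↔ Θ = Δ :=
  ⟨Ctx.code_injective Θ Δ, congrArg _⟩

/-- The type with a given Gödel number. -/
noncomputable def decodeTy : ℕ → Option Ty := Function.partialInv Ty.code

/-- The term with a given Gödel number. -/
noncomputable def decodeTm : ℕ → Option Tm := Function.partialInv Tm.code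

/-- The context with a given Gödel number. -/
noncomputable def decodeCtx : ℕ → Option Ctx := Function.partialInv Ctx.code

theorem decodeTy_eq_some {n : ℕ} {T : Ty} : decodeTy n = some T ↔ T.code = n :=
  Function.Injective.isPartialInv (fun _ _ => Ty.code_injective _ _) T n

theorem decodeTm_eq_some {n : ℕ} {t : Tm} : decodeTm n = some t ↔ t.code = n :=
  Function.Injective.isPartialInv (fun _ _ => Tm.code_injective _ _) t n

theorem decodeCtx_eq_some {n : ℕ} {Θ : Ctx} : decodeCtx n = some Θ ↔ Ctx.code Θ = n :=
  Function.Injective.isPartialInv (fun _ _ => Ctx.code_injective _ _) Θ n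

theorem decodeTy_eq_none {n : ℕ} (h : decodeTy n = none) (T : Ty) : T.code ≠ n := fun hT => by
  simp [decodeTy_eq_some.2 hT] at h

theorem decodeTm_eq_none {n : ℕ} (h : decodeTm n = none) (t : Tm) : t.code ≠ n := fun ht => by
  simp [decodeTm_eq_some.2 ht] at h

theorem decodeCtx_eq_none {n : ℕ} (h : decodeCtx n = none) (Θ : Ctx) : Ctx.code Θ ≠ n := fun hΘ => by
  simp [decodeCtx_eq_some.2 hΘ] at h

/-- This makes decoding a well-founded recursion. A nonzero constructor tag is essential: `Nat.pair
0 1 = 1` does not exceed its second component. -/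
theorem unpair_unpair_lt {n : ℕ} (h : n.unpair.1 ≠ 0) :
    n.unpair.2.unpair.1 < n ∧ n.unpair.2.unpair.2 < n := by
  have h1 : n.unpair.2 < n := by
    conv_rhs => rw [← Nat.pair_unpair n]
    unfold Nat.pair
    split_ifs <;> nlinarith [Nat.pos_of_ne_zero h]
  exact ⟨(Nat.unpair_left_le _).trans_lt h1, (Nat.unpair_right_le _).trans_lt h1⟩

theorem exists_pair (n : ℕ) : ∃ k m, n = Nat.pair k m := ⟨_, _, (Nat.pair_unpair n).symm⟩

-- Two options are equal when they contain the same types, and `decodeTy n` contains `T` exactly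
-- when `T.code = n`. Each recursion equation thus reduces to a comparison of codes, one constructor
-- at a time.
@[fun_prop]
theorem computable_decodeTy : Computable decodeTy := by
  refine computable_of_binary_rec (fun n => n) (isLeaf := fun n => ltB n.unpair.1 2)
    (l := fun n => n.unpair.2.unpair.1) (r := fun n => n.unpair.2.unpair.2)
    (base := fun n => cond (eqB n.unpair.1 0) (cond (eqB n.unpair.2 0) (some .top) none)
      (some (.var n.unpair.2)))
    (step := fun n a b => cond (ltB n.unpair.1 5 && a.isSome && b.isSome)
      (some (Ty.mk n.unpair.1 (a.getD .top) (b.getD .top))) none)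
    (by fun_prop) (by fun_prop) (by fun_prop) (by fun_prop) (by fun_prop) ?_ ?_
  · intro n h
    obtain ⟨k, m, rfl⟩ := exists_pair n
    simp only [Nat.unpair_pair, ltB_iff] at h
    ext T
    simp only [decodeTy_eq_some, Nat.unpair_pair]
    interval_cases k
    · rcases m with _ | m <;> rcases T with _ | _ | _ | ⟨_ | _, _, _⟩ <;> simp [Ty.code, eqB]
    · rcases T with _ | _ | _ | ⟨_ | _, _, _⟩ <;> simp [Ty.code, eqB, eq_comm]
  · intro n h
    have hk : 2 ≤ n.unpair.1 := by simpa only [ltB, decide_eq_false_iff_not, not_lt] using h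
    refine ⟨(unpair_unpair_lt (by omega)).1, (unpair_unpair_lt (by omega)).2, ?_⟩
    clear h
    obtain ⟨k, m, rfl⟩ := exists_pair n
    obtain ⟨l, r, rfl⟩ := exists_pair m
    simp only [Nat.unpair_pair] at hk ⊢
    ext T
    simp only [decodeTy_eq_some]
    cases hl : decodeTy l with
    | none =>
      have hl := decodeTy_eq_none hl
      rcases T with _ | _ | _ | ⟨_ | _, _, _⟩ <;> simp [Ty.code, hl] <;> omega
    | some A =>
    cases hr : decodeTy r with
    | none =>
      have hr := decodeTy_eq_none hr
      rcases T with _ | _ | _ | ⟨_ | _, _, _⟩ <;> simp [Ty.code, hr] <;> omega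
    | some B =>
      rw [decodeTy_eq_some] at hl hr
      subst hl hr
      by_cases h5 : k < 5
      · interval_cases k <;> rcases T with _ | _ | _ | ⟨_ | _, _, _⟩ <;>
          simp [Ty.code, ltB, tyCode_inj, eq_comm]
      · rcases T with _ | _ | _ | ⟨_ | _, _, _⟩ <;> simp [Ty.code, ltB, h5] <;> omega

/-- The term with a given constructor from 2 to 5, with optional components of both sorts. -/
def mkTm (k : ℕ) (s t : Option Tm) (S T : Option Ty) : Option Tm :=
  cond (eqB k 2 && S.isSome && t.isSome) (some (.lam (S.getD .top) (t.getD .top))) <|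
  cond (eqB k 3 && S.isSome && t.isSome) (some (.tlam (S.getD .top) (t.getD .top))) <|
  cond (eqB k 4 && s.isSome && t.isSome) (some (.app (s.getD .top) (t.getD .top))) <|
  cond (eqB k 5 && s.isSome && T.isSome) (some (.tapp (s.getD .top) (T.getD .top))) none

/-- Whether a component codes a type or a term depends on the tag, so both decodings of each
component are supplied and `mkTm` picks the fitting ones. -/
theorem decodeTm_pair {k l r : ℕ} (hk : 2 ≤ k) : decodeTm (Nat.pair k (Nat.pair l r)) =
    mkTm k (decodeTm l) (decodeTm r) (decodeTy l) (decodeTy r) := by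
  ext u
  rw [decodeTm_eq_some]
  by_cases h5 : k < 6
  · interval_cases k
    · cases hl : decodeTy l with
      | none =>
        have hl := decodeTy_eq_none hl
        cases u <;> simp [Tm.code, mkTm, eqB, hl]
      | some A =>
        cases hr : decodeTm r with
        | none =>
          have hr := decodeTm_eq_none hr
          cases u <;> simp [Tm.code, mkTm, eqB, hr]
        | some B =>
          rw [decodeTy_eq_some] at hl
          rw [decodeTm_eq_some] at hr
          subst hl hr
          cases u <;> simp [Tm.code, mkTm, eqB, tyCode_inj, tmCode_inj, eq_comm]
    · cases hl : decodeTy l with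
      | none =>
        have hl := decodeTy_eq_none hl
        cases u <;> simp [Tm.code, mkTm, eqB, hl]
      | some A =>
        cases hr : decodeTm r with
        | none =>
          have hr := decodeTm_eq_none hr
          cases u <;> simp [Tm.code, mkTm, eqB, hr]
        | some B =>
          rw [decodeTy_eq_some] at hl
          rw [decodeTm_eq_some] at hr
          subst hl hr
          cases u <;> simp [Tm.code, mkTm, eqB, tyCode_inj, tmCode_inj, eq_comm]
    · cases hl : decodeTm l with
      | none =>
        have hl := decodeTm_eq_none hl
        cases u <;> simp [Tm.code, mkTm, eqB, hl]
      | some A =>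
        cases hr : decodeTm r with
        | none =>
          have hr := decodeTm_eq_none hr
          cases u <;> simp [Tm.code, mkTm, eqB, hr]
        | some B =>
          rw [decodeTm_eq_some] at hl hr
          subst hl hr
          cases u <;> simp [Tm.code, mkTm, eqB, tmCode_inj, eq_comm]
    · cases hl : decodeTm l with
      | none =>
        have hl := decodeTm_eq_none hl
        cases u <;> simp [Tm.code, mkTm, eqB, hl]
      | some A =>
        cases hr : decodeTy r with
        | none =>
          have hr := decodeTy_eq_none hr
          cases u <;> simp [Tm.code, mkTm, eqB, hr]
        | some B =>
          rw [decodeTm_eq_some] at hl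
          rw [decodeTy_eq_some] at hr
          subst hl hr
          cases u <;> simp [Tm.code, mkTm, eqB, tyCode_inj, tmCode_inj, eq_comm]
  · have h2 : k ≠ 2 := by omega
    have h3 : k ≠ 3 := by omega
    have h4 : k ≠ 4 := by omega
    have h5 : k ≠ 5 := by omega
    cases u <;> simp [Tm.code, mkTm, eqB, h2, h3, h4, h5] <;> omega

@[fun_prop]
theorem computable_decodeTm : Computable decodeTm := by
  refine computable_of_binary_rec (fun n => n) (isLeaf := fun n => ltB n.unpair.1 2)
    (l := fun n => n.unpair.2.unpair.1) (r := fun n => n.unpair.2.unpair.2)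
    (base := fun n => cond (eqB n.unpair.1 0) (cond (eqB n.unpair.2 0) (some .top) none)
      (some (.var n.unpair.2)))
    (step := fun n a b => mkTm n.unpair.1 a b (decodeTy n.unpair.2.unpair.1)
      (decodeTy n.unpair.2.unpair.2))
    (by fun_prop) (by fun_prop) (by fun_prop) (by fun_prop) (by unfold mkTm; fun_prop) ?_ ?_
  · intro n h
    obtain ⟨k, m, rfl⟩ := exists_pair n
    simp only [Nat.unpair_pair, ltB_iff] at h
    ext t
    simp only [decodeTm_eq_some, Nat.unpair_pair]
    interval_cases k
    · rcases m with _ | m <;> cases t <;> simp [Tm.code, eqB]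
    · cases t <;> simp [Tm.code, eqB, eq_comm]
  · intro n h
    have hk : 2 ≤ n.unpair.1 := by simpa only [ltB, decide_eq_false_iff_not, not_lt] using h
    refine ⟨(unpair_unpair_lt (by omega)).1, (unpair_unpair_lt (by omega)).2, ?_⟩
    clear h
    obtain ⟨k, m, rfl⟩ := exists_pair n
    obtain ⟨l, r, rfl⟩ := exists_pair m
    simp only [Nat.unpair_pair] at hk ⊢
    exact decodeTm_pair hk

@[fun_prop]
theorem computable_decodeCtx : Computable decodeCtx := by
  refine computable_of_binary_rec (fun n => n) (isLeaf := fun n => eqB n.unpair.1 0)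
    (l := fun n => n.unpair.2.unpair.1) (r := fun n => n.unpair.2.unpair.2)
    (base := fun n => cond (eqB n.unpair.2 0) (some []) none)
    (step := fun n _ b => cond
      (ltB n.unpair.1 3 && (decodeTy n.unpair.2.unpair.1).isSome && b.isSome)
      (some (cond (eqB n.unpair.1 1) (.ty ((decodeTy n.unpair.2.unpair.1).getD .top))
        (.tm ((decodeTy n.unpair.2.unpair.1).getD .top)) :: b.getD [])) none)
    (by fun_prop) (by fun_prop) (by fun_prop) (by fun_prop) (by fun_prop) ?_ ?_
  · intro n h
    obtain ⟨k, m, rfl⟩ := exists_pair n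
    simp only [Nat.unpair_pair, eqB_iff] at h
    subst h
    ext Θ
    simp only [decodeCtx_eq_some, Nat.unpair_pair]
    rcases m with _ | m <;> rcases Θ with _ | ⟨_ | _, _⟩ <;> simp [Ctx.code, eqB]
  · intro n h
    have hk : n.unpair.1 ≠ 0 := by simpa [eqB] using h
    refine ⟨(unpair_unpair_lt hk).1, (unpair_unpair_lt hk).2, ?_⟩
    clear h
    obtain ⟨k, m, rfl⟩ := exists_pair n
    obtain ⟨l, r, rfl⟩ := exists_pair m
    simp only [Nat.unpair_pair] at hk ⊢
    ext Θ
    simp only [decodeCtx_eq_some]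
    cases hl : decodeTy l with
    | none =>
      have hl := decodeTy_eq_none hl
      rcases Θ with _ | ⟨_ | _, _⟩ <;> (simp [Ctx.code, hl]; try omega)
    | some A =>
    cases hr : decodeCtx r with
    | none =>
      have hr := decodeCtx_eq_none hr
      rcases Θ with _ | ⟨_ | _, _⟩ <;> (simp [Ctx.code, hr]; try omega)
    | some B =>
      rw [decodeTy_eq_some] at hl
      rw [decodeCtx_eq_some] at hr
      subst hl hr
      by_cases h3 : k < 3
      · interval_cases k
        · omega
        all_goals rcases Θ with _ | ⟨_ | _, _⟩ <;>
          simp [Ctx.code, ltB, eqB, tyCode_inj, ctxCode_inj] <;>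
          exact and_congr eq_comm eq_comm
      · rcases Θ with _ | ⟨_ | _, _⟩ <;> (simp [Ctx.code, ltB, h3]; try omega)

/-! ### Decidability of typechecking -/

/-- The typing problem with a given Gödel number is a problem for terms and types in which all
quantifiers are `∀^⊤`. -/
noncomputable def isProblem (k : ℕ) : Bool :=
  (decodeCtx k.unpair.1).isSome && (decodeTm k.unpair.2.unpair.1).isSome &&
  (decodeTy k.unpair.2.unpair.2).isSome &&
  (wfCheck ((decodeCtx k.unpair.1).getD []) ((decodeTy k.unpair.2.unpair.2).getD .top) &&
  Ctx.ftopB ((decodeCtx k.unpair.1).getD []) &&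
  ((decodeTm k.unpair.2.unpair.1).getD .top).ftopB &&
  ((decodeTy k.unpair.2.unpair.2).getD .top).ftopB)

/-- The typechecking procedure, with recursion depth at most `n`, on Gödel numbers. -/
noncomputable def typecheckCode (k n : ℕ) : Option Bool :=
  cond (isProblem k) (typecheck n ((decodeCtx k.unpair.1).getD [])
    ((decodeTm k.unpair.2.unpair.1).getD .top) ((decodeTy k.unpair.2.unpair.2).getD .top))
    (some false)

theorem computable_typecheckCode : Computable₂ typecheckCode := by
  change Computable fun x : ℕ × ℕ => typecheckCode x.1 x.2
  unfold typecheckCode isProblem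
  fun_prop

theorem isProblem_problemCode (Θ : Ctx) (t : Tm) (T : Ty) :
    isProblem (problemCode Θ t T) = true ↔ FTopTerm Θ t ∧ FTopType Θ T := by
  simp only [isProblem, problemCode, Nat.unpair_pair, decodeCtx_eq_some.2 rfl,
    decodeTm_eq_some.2 rfl, decodeTy_eq_some.2 rfl, Option.isSome_some, Option.getD_some,
    Bool.and_eq_true, Ctx.ftopB_iff, Tm.ftopB_iff, Ty.ftopB_iff, FTopTerm, FTopType,
    ← wf_iff_wfCheck]
  constructor
  · rintro ⟨-, ⟨⟨h1, h2⟩, h3⟩, h4⟩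
    exact ⟨⟨wf_top_iff.2 h1.check.1, h2, h3⟩, h1, h2, h4⟩
  · rintro ⟨⟨-, h2, h3⟩, h1, -, h4⟩
    exact ⟨by simp, ⟨⟨h1, h2⟩, h3⟩, h4⟩

theorem typecheckCode_mono {k m n : ℕ} (hmn : m ≤ n) {b : Bool}
    (h : typecheckCode k m = some b) : typecheckCode k n = some b := by
  unfold typecheckCode at h ⊢
  cases hk : isProblem k <;> rw [hk] at h
  · exact h
  · exact typecheck_mono hmn h

theorem exists_problemCode_of_isProblem {k : ℕ} (h : isProblem k = true) :
    ∃ Θ t T, problemCode Θ t T = k := by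
  simp only [isProblem, Bool.and_eq_true] at h
  obtain ⟨⟨⟨h1, h2⟩, h3⟩, -⟩ := h
  obtain ⟨Θ, hΘ⟩ := Option.isSome_iff_exists.1 h1
  obtain ⟨t, ht⟩ := Option.isSome_iff_exists.1 h2
  obtain ⟨T, hT⟩ := Option.isSome_iff_exists.1 h3
  refine ⟨Θ, t, T, ?_⟩
  rw [problemCode, decodeCtx_eq_some.1 hΘ, decodeTm_eq_some.1 ht, decodeTy_eq_some.1 hT,
    Nat.pair_unpair, Nat.pair_unpair]

/-- Numbers that do not code a problem of the fragment are rejected at every depth. For the others,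
injectivity of the coding identifies the coded problem with any witness of the existential. -/
theorem typecheckCode_spec (k : ℕ) : ∃ b, Returns (typecheckCode k) b ∧
    (b = true ↔ ∃ (Θ : Ctx) (t : Tm) (T : Ty),
      problemCode Θ t T = k ∧ FTopTerm Θ t ∧ FTopType Θ T ∧ Typing Θ t T) := by
  cases hk : isProblem k with
  | false =>
    refine ⟨false, ⟨0, fun n _ => by simp [typecheckCode, hk]⟩, ?_⟩
    simp only [Bool.false_eq_true, false_iff]
    rintro ⟨Θ, t, T, rfl, ht, hT, -⟩
    rw [(isProblem_problemCode Θ t T).2 ⟨ht, hT⟩] at hk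
    cases hk
  | true =>
    obtain ⟨Θ, t, T, rfl⟩ := exists_problemCode_of_isProblem hk
    obtain ⟨ht, hT⟩ := (isProblem_problemCode Θ t T).1 hk
    obtain ⟨b, hb, hiff⟩ := typecheck_spec ht hT
    refine ⟨b, ?_, hiff.trans ⟨fun h => ⟨Θ, t, T, rfl, ht, hT, h⟩, ?_⟩⟩
    · have : typecheckCode (problemCode Θ t T) = fun n => typecheck n Θ t T := by
        funext n
        simp only [typecheckCode, hk, cond_true]
        simp only [problemCode, Nat.unpair_pair, decodeCtx_eq_some.2 rfl,
          decodeTm_eq_some.2 rfl, decodeTy_eq_some.2 rfl, Option.getD_some]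
      rwa [this]
    · rintro ⟨Θ', t', T', h, -, -, hty⟩
      obtain ⟨rfl, rfl, rfl⟩ := problemCode_injective h
      exact hty

/-- The depth that suffices is not bounded computably; it is found by unbounded search, which always
succeeds by termination. -/
theorem computablePred_typing : ComputablePred fun k : ℕ => ∃ (Θ : Ctx) (t : Tm) (T : Ty),
    problemCode Θ t T = k ∧ FTopTerm Θ t ∧ FTopType Θ T ∧ Typing Θ t T := by
  classical
  refine ⟨Classical.decPred _, ?_⟩
  refine Partrec.of_eq (Partrec.rfindOpt computable_typecheckCode) fun k => ?_
  obtain ⟨b, ⟨N, hN⟩, hiff⟩ := typecheckCode_spec k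
  have hb : decide (∃ (Θ : Ctx) (t : Tm) (T : Ty),
      problemCode Θ t T = k ∧ FTopTerm Θ t ∧ FTopType Θ T ∧ Typing Θ t T) = b := by
    rw [Bool.eq_iff_iff, decide_eq_true_iff, hiff]
  -- By monotonicity, the first answer met by the search agrees with the answer at the sufficient
  -- depth `N`.
  refine Part.eq_some_iff.2 ((Nat.rfindOpt_mono fun hmn h => typecheckCode_mono hmn h).2 ⟨N, ?_⟩)
  exact (hN N le_rfl).trans (congrArg some hb.symm)

end FSub

theorem mainTheorem2 :
    -- minimal typing terminates, and it produces types in the grammar of minimal types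
    (∀ (Θ : FSub.Ctx) (t : FSub.Tm), FSub.FTopTerm Θ t →
      ∃ r : Option FSub.Ty, FSub.Returns (fun n => FSub.synth n Θ t) r ∧
        ∀ S : FSub.Ty, r = some S → FSub.Wf Θ S ∧ S.IsMinimal) ∧
    -- subtyping terminates on these types
    (∀ (Θ : FSub.Ctx) (S T : FSub.Ty), FSub.Wf Θ S → S.IsMinimal → FSub.FTopType Θ T →
      FSub.Terminates (fun n => FSub.subtype n Θ S T)) ∧
    -- the typechecking procedure terminates with the correct answer
    (∀ (Θ : FSub.Ctx) (t : FSub.Tm) (T : FSub.Ty), FSub.FTopTerm Θ t → FSub.FTopType Θ T →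
      ∃ b : Bool, FSub.Returns (fun n => FSub.typecheck n Θ t T) b ∧
        (b = true ↔ FSub.Typing Θ t T)) ∧
    -- typechecking is decidable
    ComputablePred (fun k : ℕ => ∃ (Θ : FSub.Ctx) (t : FSub.Tm) (T : FSub.Ty),
      FSub.problemCode Θ t T = k ∧ FSub.FTopTerm Θ t ∧ FSub.FTopType Θ T ∧
        FSub.Typing Θ t T) :=
  ⟨fun _ _ => FSub.synth_spec,
    fun _ _ _ _ hS hT => FSub.subtype_terminates hT.2.1 hS hT.2.2,
    fun _ _ _ => FSub.typecheck_spec, FSub.computablePred_typing⟩
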